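/- Let $\mathcal V$ be a finite alphabet, $\mathcal X,\mathcal Y$ discrete alphabets, $c$ a sensor range, $\Psi:\mathcal V^c\to\mathcal X$ a sensing function, $P_{Y|X}(\cdot|x)$ a p.m.f. on $\mathcal Y$ for each $x\in\mathcal X$, and $P_V$ a p.m.f. on $\mathcal V$. A sensor network $s(k,n)$ consists of $n$ sensors, each with $c$ connections (repetitions allowed) to the $k$ positions of a target vector $\boldsymbol v\in\mathcal V^k$. Sensor $\ell$ has ideal output $x_\ell=\Psi(v_{\ell t_1},\dots,v_{\ell t_c})$, and given the ideal outputs the observed outputs $y_\ell$ are independent with laws $P_{Y|X}(\cdot|x_\ell)$. The positions of $\boldsymbol v$ are i.i.d. with distribution $P_V$, and $\boldsymbol v$ is detected from $\boldsymbol y$ by a maximum a posteriori (MAP) detector $g$. For $D\in[0,1]$ there is an error if $\frac1k d_{\mathrm H}(\boldsymbol v,g(\boldsymbol y))\ge D$, where $d_{\mathrm H}$ is the Hamming distance. The sensing capacity $C(D)\in[0,\infty]$ is the largest $C$ such that for every rate $R$ with $0<R<C$ there is a sequence of sensor networks $s(\lceil nR\rceil,n)$ whose error probability under MAP detection, averaged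 over $\boldsymbol v$, tends to $0$ as $n\to\infty$ (however the ties in the MAP rule are broken). Then $$C(D)\ \ge\ C_{LB}(D)=\min_{\lambda}\ \frac{D\left(P_{X_iY}^{\gamma_i}\,\|\,Q_{X_iY}^{\lambda}\right)}{H(\lambda)-H(\gamma_j)-D(\gamma_j\|P_V)},$$ where the minimum is over all p.m.f.s $\lambda=(\lambda_{ab})_{a,b\in\mathcal V}$ with $\sum_b\lambda_{ab}=\gamma_{ia}$ for all $a$ and $\sum_{a\ne b}\lambda_{ab}\ge D$, and it is attained if there is such a $\lambda$ (otherwise $C_{LB}(D)=\infty$). Here $\gamma_i=P_V$, and $\gamma_{jb}=\sum_a\lambda_{ab}$ is the second marginal of $\lambda$. $H$ and $D(\cdot\|\cdot)$ are entropy and Kullback–Leibler distance, in bits. Further, $P^{\gamma}$ is the law of $\Psi(A_1,\dots,A_c)$ for i.i.d. $A_u\sim\gamma$, and $P^\lambda$ is the joint law of $(\Psi(A_1,\dots,A_c),\Psi(B_1,\dots,B_c))$ for i.i.d. pairs $(A_u,B_u)\sim\lambda$; with these, $P^{\gamma}_{X_iY}(x,y)=P^\gamma(x)P_{Y|X}(y|x)$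 and $Q^\lambda_{X_iY}(x,y)=\sum_{a\in\mathcal X}P^\lambda(x,a)P_{Y|X}(y|a)$. The quotient is read as the supremum in $[0,\infty]$ of the rates $R>0$ for which the numerator exceeds $R$ times the denominator: it is $\infty$ if the denominator is negative, and, for a zero denominator, $\infty$ if the numerator is positive and $0$ if it is zero. -/

import Mathlib

open scoped ENNReal NNReal Topology

noncomputable section

namespace SensingCapacity

/-! ### Entropies in bits -/

/-- Shannon entropy, in bits, of a distribution on a finite alphabet. -/
def entropy {α : Type*} [Fintype α] (p : PMF α) : ℝ :=
  (∑ a, Real.negMulLog (p a).toReal) / Real.log 2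

/-- Kullback-Leibler distance `D(p‖q)`, in bits, of two discrete distributions; its value is `∞`
when `p` is not absolutely continuous with respect to `q`. -/
def relEntropy {α : Type*} (p q : PMF α) : ℝ≥0∞ :=
  InformationTheory.klDiv (@PMF.toMeasure α ⊤ p) (@PMF.toMeasure α ⊤ q) /
    ENNReal.ofReal (Real.log 2)

/-- The distribution of `n` independent draws from `p`. -/
def iid {α : Type*} [Fintype α] (n : ℕ) (p : PMF α) : PMF (Fin n → α) :=
  PMF.ofFintype (fun w => ∏ u, p (w u)) (by
    classical
    have h : ∑ a, p a = 1 := by rw [← tsum_fintype (L := .unconditional _), p.tsum_coe]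
    rw [← Fintype.piFinset_univ, Finset.sum_prod_piFinset]
    simp [h])

/-! ### The arbitrary connections model -/

/-- The data of the model: a sensor has range `c`, its ideal output is the function `Ψ` of the `c`
targets that it senses, the observed output is drawn from the noise p.m.f. `noise x = P_{Y|X}(·|x)`
given the ideal output `x`, and target positions are i.i.d. with distribution `prior = P_V`. -/
structure Model (V X Y : Type*) where
  c : ℕ
  Ψ : (Fin c → V) → X
  noise : X → PMF Y
  prior : PMF V

/-- A sensor network `s(k, n)` of range `c`: the `u`-th connection of sensor `ℓ` leads to the target
position `s ℓ u`. A sensor may connect to the same position more than once. -/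
abbrev Network (c k n : ℕ) : Type := Fin n → Fin c → Fin k

namespace Model

variable {V X Y : Type*} (M : Model V X Y)

/-- The codeword (ideal output vector) of the target vector `v` in the sensor network `s`. -/
def codeword {k n : ℕ} (s : Network M.c k n) (v : Fin k → V) : Fin n → X :=
  fun ℓ => M.Ψ (fun u => v (s ℓ u))

/-- The a priori probability of a target vector. -/
def priorProb {k : ℕ} (v : Fin k → V) : ℝ≥0∞ := ∏ t, M.prior (v t)

/-- The probability that the sensor outputs are `y` given that the ideal outputs are `x`. -/
def likelihood {n : ℕ} (x : Fin n → X) (y : Fin n → Y) : ℝ≥0∞ := ∏ ℓ, M.noise (x ℓ) (y ℓ)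

/-- `g` is a maximum a posteriori detector for the network `s`; ties are broken arbitrarily. -/
def IsMAP {k n : ℕ} (s : Network M.c k n) (g : (Fin n → Y) → (Fin k → V)) : Prop :=
  ∀ (y : Fin n → Y) (v : Fin k → V),
    M.priorProb v * M.likelihood (M.codeword s v) y ≤
      M.priorProb (g y) * M.likelihood (M.codeword s (g y)) y

/-- `w` lies in the tolerable distortion region of `v`. -/
def Tolerable [DecidableEq V] (D : ℝ) {k : ℕ} (v w : Fin k → V) : Prop :=
  (hammingDist v w : ℝ) / k < D

open Classical in
/-- The probability of error of the network `s` and the detector `g`, averaged over the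
target vectors according to the prior. -/
def errorProb [Fintype V] [DecidableEq V] (D : ℝ) {k n : ℕ} (s : Network M.c k n)
    (g : (Fin n → Y) → (Fin k → V)) : ℝ≥0∞ :=
  ∑ v : Fin k → V, M.priorProb v *
    ∑' y : Fin n → Y, if Tolerable D v (g y) then 0 else M.likelihood (M.codeword s v) y

/-- There is a sequence of sensor networks `s(⌈nR⌉, n)` whose error probability under MAP detection
(however ties are broken) tends to zero. -/
def Achievable [Fintype V] [DecidableEq V] (D R : ℝ) : Prop :=
  ∃ s : (n : ℕ) → Network M.c ⌈(n : ℝ) * R⌉₊ n,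
    ∀ g : (n : ℕ) → (Fin n → Y) → (Fin ⌈(n : ℝ) * R⌉₊ → V),
      (∀ n, M.IsMAP (s n) (g n)) →
        Filter.Tendsto (fun n => M.errorProb D (s n) (g n)) Filter.atTop (𝓝 0)

/-- The sensing capacity `C(D)` (possibly infinite): the largest rate below which all positive rates
are achievable. -/
def capacity [Fintype V] [DecidableEq V] (D : ℝ) : ℝ≥0∞ :=
  sSup {C : ℝ≥0∞ | ∀ R : ℝ, 0 < R → ENNReal.ofReal R < C → M.Achievable D R}

/-! ### The lower bound -/

variable [Fintype V]

/-- `P^γ`: the law of the ideal output of a sensor whose `c` connections sense i.i.d. targets of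
distribution `γ`. -/
def outputLaw (γ : PMF V) : PMF X := (iid M.c γ).map M.Ψ

/-- `P^λ`: the joint law of the ideal outputs of one random sensor for two target vectors of joint
type `l`. -/
def jointOutputLaw (l : PMF (V × V)) : PMF (X × X) :=
  (iid M.c l).map (fun w => (M.Ψ (fun u => (w u).1), M.Ψ (fun u => (w u).2)))

/-- `P_{X_i Y}^γ (x, y) = P^γ(x) P_{Y|X}(y|x)`. -/
def lawP (γ : PMF V) : PMF (X × Y) :=
  (M.outputLaw γ).bind fun x => (M.noise x).map fun y => (x, y)

/-- `Q_{X_i Y}^λ (x, y) = ∑ a, P^λ(x, a) P_{Y|X}(y|a)`. -/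
def lawQ (l : PMF (V × V)) : PMF (X × Y) :=
  (M.jointOutputLaw l).bind fun x => (M.noise x.2).map fun y => (x.1, y)

/-- The p.m.f.s `λ` on `V × V` with first marginal `P_V` and off-diagonal mass at least `D`. -/
def feasible [DecidableEq V] (D : ℝ) : Set (PMF (V × V)) :=
  {l | l.map Prod.fst = M.prior ∧
    ENNReal.ofReal D ≤ ∑ p : V × V, if p.1 ≠ p.2 then l p else 0}

/-- `H(λ) - H(γ_j) - D(γ_j‖P_V)`, where `γ_j` is the second marginal of `λ`; it may be negative or
`-∞`. -/
def denominator (l : PMF (V × V)) : EReal :=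
  ((entropy l - entropy (l.map Prod.snd) : ℝ) : EReal) -
    ((relEntropy (l.map Prod.snd) M.prior : ℝ≥0∞) : EReal)

/-- The quotient `D(P_{X_i Y}^{P_V} ‖ Q_{X_i Y}^λ) / (H(λ) - H(γ_j) - D(γ_j‖P_V))`, i.e. the
supremum of the rates `R > 0` for which the numerator exceeds `R` times the denominator: it is `∞`
when the denominator is negative, and for a zero denominator it is `∞` if the numerator is positive
and `0` if the numerator is zero. -/
def quotient (l : PMF (V × V)) : ℝ≥0∞ :=
  if M.denominator l < 0 then ∞
  else relEntropy (M.lawP M.prior) (M.lawQ l) / (M.denominator l).toENNReal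

/-- `C_LB(D)`; it is `∞` when there is no feasible `λ`. -/
def lowerBound [DecidableEq V] (D : ℝ) : ℝ≥0∞ := ⨅ l ∈ M.feasible D, M.quotient l

end Model

end SensingCapacity

end

/-!
Connect every sensor to uniformly random positions. For a target vector `v` and the vectors `w` of
joint type `λ` with it, the output of one sensor has law `P^γ` together with the codeword letter
of `v`, and law `Q^λ` when it is caused by `w` instead. Gallager's union bound with exponent
`ρ ∈ (0, 1]` and Hölder's inequality therefore bound the average probability of confusing `v` with
some such `w` by `P(v)^{-ρ} (∑ P(w))^ρ (∑ (P^γ)^{1-ρ} (Q^λ)^ρ)^n`. By the method of types the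
product of the first two factors is at most `exp(ρ k (h(γ) - D(λ‖γ ⊗ P_V)))`, where `h(γ)` is the
cross entropy of `γ` and `P_V`, and for `γ = P_V` the chain rule identifies this exponent with the
denominator of the quotient. The last factor is at most `exp(-n ρ T_ρ(P^γ‖Q^λ))`, where the Tsallis
divergences `T_ρ` are lower semicontinuous and increase to the Kullback-Leibler divergence as
`ρ ↓ 0`. As the p.m.f.s on `V × V` form a compact space, one `ρ` serves all joint types at once:
every `λ` with off-diagonal mass at least `D` either has an atypical `γ` or is exponentially
unlikely to cause an error, and there are only polynomially many joint types.
-/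

noncomputable section

namespace SensingCapacity

open Filter MeasureTheory InformationTheory

section NegativeExponential

/-- The function `x ↦ e^{-x}` on `[0, ∞]`, with `e^{-∞} = 0`. -/
def expNeg (x : ℝ≥0∞) : ℝ≥0∞ := (-(x : EReal)).exp

theorem expNeg_top : expNeg ∞ = 0 := by simp [expNeg]

theorem expNeg_ofReal {a : ℝ} (ha : 0 ≤ a) :
    expNeg (ENNReal.ofReal a) = ENNReal.ofReal (Real.exp (-a)) := by
  rw [expNeg, EReal.coe_ennreal_ofReal, max_eq_left ha, ← EReal.coe_neg, EReal.exp_coe]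

theorem expNeg_antitone : Antitone expNeg := fun _ _ h =>
  EReal.exp_monotone (EReal.neg_le_neg_iff.2 (EReal.coe_ennreal_le_coe_ennreal_iff.2 h))

theorem expNeg_add (x y : ℝ≥0∞) : expNeg (x + y) = expNeg x * expNeg y := by
  rw [expNeg, EReal.coe_ennreal_add, EReal.neg_add (by simp) (by simp), sub_eq_add_neg,
    EReal.exp_add, expNeg, expNeg]

theorem expNeg_natCast_mul (n : ℕ) (x : ℝ≥0∞) : expNeg (n * x) = expNeg x ^ n := by
  induction n with
  | zero => simp [expNeg]
  | succ n ih => rw [Nat.cast_succ, add_mul, one_mul, expNeg_add, ih, pow_succ]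

theorem expNeg_ofReal_mul {ρ : ℝ} (hρ : 0 ≤ ρ) (x : ℝ≥0∞) :
    expNeg (ENNReal.ofReal ρ * x) = expNeg x ^ ρ := by
  rw [expNeg, EReal.coe_ennreal_mul, EReal.coe_ennreal_ofReal, max_eq_left hρ, mul_comm, ← neg_mul,
    EReal.exp_mul, expNeg]

theorem le_expNeg_of_add_le_one {x y : ℝ≥0∞} (h : x + y ≤ 1) : x ≤ expNeg y := by
  have hy : y ≠ ∞ := ((le_add_self.trans h).trans_lt ENNReal.one_lt_top).ne
  have hxy : x ≤ 1 - y := ENNReal.le_sub_of_add_le_right hy h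
  lift y to ℝ≥0 using hy
  rw [← ENNReal.ofReal_coe_nnreal, expNeg_ofReal y.coe_nonneg]
  refine hxy.trans ?_
  rw [← ENNReal.ofReal_coe_nnreal, ← ENNReal.ofReal_one, ← ENNReal.ofReal_sub _ y.coe_nonneg]
  exact ENNReal.ofReal_le_ofReal (Real.one_sub_le_exp_neg y)

end NegativeExponential

section Basic

variable {α β : Type*}

theorem sum_coe_eq_one [Fintype α] (p : PMF α) : ∑ a, p a = 1 := by
  rw [← tsum_fintype (L := .unconditional _), p.tsum_coe]

theorem sum_toReal_eq_one [Fintype α] (p : PMF α) : ∑ a, (p a).toReal = 1 := by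
  rw [← ENNReal.toReal_sum fun a _ => p.apply_ne_top a, sum_coe_eq_one, ENNReal.toReal_one]

theorem exists_le_sum_mul [Fintype α] (p : PMF α) (f : α → ℝ≥0∞) : ∃ a, f a ≤ ∑ b, p b * f b := by
  have : Nonempty α := p.support_nonempty.to_type
  obtain ⟨a, ha⟩ := Finite.exists_min f
  refine ⟨a, ?_⟩
  calc f a = ∑ b, p b * f a := by rw [← Finset.sum_mul, sum_coe_eq_one, one_mul]
    _ ≤ ∑ b, p b * f b := by gcongr with b; exact ha b

theorem sum_map_toReal_mul [Fintype α] [Fintype β] (p : PMF α) (g : α → β) (f : β → ℝ) :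
    ∑ b, (p.map g b).toReal * f b = ∑ a, (p a).toReal * f (g a) := by
  classical
  have hmap : ∀ b, (p.map g b).toReal = ∑ a, if b = g a then (p a).toReal else 0 := fun b => by
    rw [PMF.map_apply, tsum_fintype, ENNReal.toReal_sum fun a _ => by
      split_ifs <;> simp [p.apply_ne_top]]
    exact Finset.sum_congr rfl fun a _ => by split_ifs <;> rfl
  simp only [hmap, Finset.sum_mul]
  rw [Finset.sum_comm]
  simp [ite_mul]

end Basic

section KullbackLeibler

variable {α : Type*}

theorem lintegral_toMeasure [MeasurableSpace α] (p : PMF α) {f : α → ℝ≥0∞} (hf : Measurable f) :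
    ∫⁻ a, f a ∂p.toMeasure = ∑' a, p a * f a := by
  have hsum : p.toMeasure = Measure.sum fun a => p a • Measure.dirac a := by
    ext s hs
    rw [PMF.toMeasure_apply _ hs, Measure.sum_apply _ hs]
    refine tsum_congr fun a => ?_
    by_cases ha : a ∈ s <;> simp [Measure.dirac_apply' _ hs, ha]
  rw [hsum, lintegral_sum_measure]
  refine tsum_congr fun a => ?_
  rw [lintegral_smul_measure, lintegral_dirac' a hf, smul_eq_mul]

theorem sum_mul_rpow_mul_rpow_le [Fintype α] (p : PMF α) (f g : α → ℝ≥0∞) {ρ : ℝ}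
    (hρ : ρ ∈ Set.Icc 0 1) :
    ∑ a, p a * (f a ^ (1 - ρ) * g a ^ ρ) ≤ (∑ a, p a * f a) ^ (1 - ρ) * (∑ a, p a * g a) ^ ρ := by
  let _ : MeasurableSpace α := ⊤
  have hint (h : α → ℝ≥0∞) : ∑ a, p a * h a = ∫⁻ a, h a ∂p.toMeasure := by
    rw [lintegral_toMeasure p (measurable_from_top), tsum_fintype]
  simp only [hint]
  exact ENNReal.lintegral_mul_norm_pow_le measurable_from_top.aemeasurable
    measurable_from_top.aemeasurable (sub_nonneg.2 hρ.2) hρ.1 (sub_add_cancel 1 ρ)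

/-- Kullback-Leibler distance, in nats, of two discrete distributions. -/
def kl (p q : PMF α) : ℝ≥0∞ :=
  klDiv (@PMF.toMeasure α ⊤ p) (@PMF.toMeasure α ⊤ q)

theorem kl_eq_top {p q : PMF α} {a : α} (hq : q a = 0) (hp : p a ≠ 0) : kl p q = ∞ := by
  let _ : MeasurableSpace α := ⊤
  refine klDiv_of_not_ac fun hac => hp ?_
  have ha : p.toMeasure {a} = 0 :=
    hac (by rw [PMF.toMeasure_apply_singleton _ _ (.of_discrete), hq])
  rwa [PMF.toMeasure_apply_singleton _ _ (.of_discrete)] at ha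

theorem toMeasure_absolutelyContinuous [MeasurableSpace α] {p q : PMF α}
    (h : ∀ a, q a = 0 → p a = 0) : p.toMeasure ≪ q.toMeasure := by
  refine Measure.AbsolutelyContinuous.mk fun s hs hq => ?_
  rw [PMF.toMeasure_apply_eq_zero_iff _ hs, Set.disjoint_left] at hq ⊢
  exact fun a ha => hq (mt (h a) ha)

theorem mul_rnDeriv_toMeasure [MeasurableSpace α] [DiscreteMeasurableSpace α] {p q : PMF α}
    (h : ∀ a, q a = 0 → p a = 0) (a : α) :
    q a * p.toMeasure.rnDeriv q.toMeasure a = p a := by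
  have hint := Measure.setLIntegral_rnDeriv (toMeasure_absolutelyContinuous h) {a}
  rwa [PMF.toMeasure_apply_singleton _ _ (.of_discrete), ← lintegral_indicator (.of_discrete),
    lintegral_toMeasure _ (.of_discrete),
    tsum_eq_single a fun b hb => by rw [Set.indicator_of_notMem (by simpa using hb), mul_zero],
    Set.indicator_of_mem (Set.mem_singleton a)] at hint

/-- The summand `x log (x / y) + y - x` of the Kullback-Leibler distance, with value `∞` for
`y = 0 ≠ x`. -/
def klTerm (x y : ℝ) : ℝ≥0∞ :=
  open Classical in if y = 0 ∧ x ≠ 0 then ∞ else ENNReal.ofReal (y * klFun (x / y))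

theorem klTerm_of_ac {x y : ℝ} (h : y = 0 → x = 0) :
    klTerm x y = ENNReal.ofReal (y * klFun (x / y)) :=
  if_neg fun hxy => hxy.2 (h hxy.1)

theorem mul_klFun_div {x y : ℝ} (h : y = 0 → x = 0) :
    y * klFun (x / y) = x * Real.log (x / y) + y - x := by
  rcases eq_or_ne y 0 with rfl | hy
  · simp [h rfl]
  · rw [klFun_apply]; field_simp

theorem kl_eq_tsum (p q : PMF α) : kl p q = ∑' a, klTerm (p a).toReal (q a).toReal := by
  let _ : MeasurableSpace α := ⊤
  by_cases h : ∀ a, q a = 0 → p a = 0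
  · rw [kl, klDiv_eq_lintegral_klFun_of_ac (toMeasure_absolutelyContinuous h),
      lintegral_toMeasure _ (.of_discrete)]
    refine tsum_congr fun a => ?_
    rcases eq_or_ne (q a) 0 with hq | hq
    · simp [klTerm, hq, h a hq]
    have hq' : (q a).toReal ≠ 0 := ENNReal.toReal_ne_zero.2 ⟨hq, q.apply_ne_top a⟩
    rw [klTerm_of_ac fun h0 => absurd h0 hq', ← mul_rnDeriv_toMeasure h a, ENNReal.toReal_mul,
      mul_div_cancel_left₀ _ hq', ENNReal.ofReal_mul ENNReal.toReal_nonneg,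
      ENNReal.ofReal_toReal (q.apply_ne_top a)]
  · push Not at h
    obtain ⟨a, hq, hp⟩ := h
    rw [kl_eq_top hq hp]
    refine (ENNReal.tsum_eq_top_of_eq_top ⟨a, if_pos ⟨by simp [hq], ?_⟩⟩).symm
    exact ENNReal.toReal_ne_zero.2 ⟨hp, p.apply_ne_top a⟩

theorem kl_eq_zero_iff {p q : PMF α} : kl p q = 0 ↔ p = q := by
  let _ : MeasurableSpace α := ⊤
  rw [kl, klDiv_eq_zero_iff, PMF.toMeasure_inj]

section Fintype

variable [Fintype α] {p q : PMF α}

theorem sum_mul_klFun_div (h : ∀ a, q a = 0 → p a = 0) :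
    ∑ a, (q a).toReal * klFun ((p a).toReal / (q a).toReal) =
      ∑ a, (p a).toReal * Real.log ((p a).toReal / (q a).toReal) := by
  have hac : ∀ a, (q a).toReal = 0 → (p a).toReal = 0 := fun a hq => by
    rw [h a ((ENNReal.toReal_eq_zero_iff _).1 hq |>.resolve_right (q.apply_ne_top a)),
      ENNReal.toReal_zero]
  rw [Finset.sum_congr rfl fun a _ => mul_klFun_div (hac a), Finset.sum_sub_distrib,
    Finset.sum_add_distrib, sum_toReal_eq_one, sum_toReal_eq_one, add_sub_cancel_right]

theorem sum_mul_log_div_nonneg (h : ∀ a, q a = 0 → p a = 0) :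
    0 ≤ ∑ a, (p a).toReal * Real.log ((p a).toReal / (q a).toReal) := by
  rw [← sum_mul_klFun_div h]
  exact Finset.sum_nonneg fun a _ =>
    mul_nonneg ENNReal.toReal_nonneg (klFun_nonneg (by positivity))

theorem kl_eq_ofReal_sum (h : ∀ a, q a = 0 → p a = 0) :
    kl p q = ENNReal.ofReal (∑ a, (p a).toReal * Real.log ((p a).toReal / (q a).toReal)) := by
  rw [← sum_mul_klFun_div h, ENNReal.ofReal_sum_of_nonneg fun a _ =>
    mul_nonneg ENNReal.toReal_nonneg (klFun_nonneg (by positivity)), kl_eq_tsum, tsum_fintype]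
  refine Finset.sum_congr rfl fun a _ => klTerm_of_ac fun hq => ?_
  rw [h a ((ENNReal.toReal_eq_zero_iff _).1 hq |>.resolve_right (q.apply_ne_top a)),
    ENNReal.toReal_zero]

end Fintype

end KullbackLeibler

section MeanGap

variable {ρ σ x y : ℝ}

/-- The gap `(1 - ρ) x + ρ y - x^(1-ρ) y^ρ` in the weighted AM-GM inequality. -/
def meanGap (ρ x y : ℝ) : ℝ := (1 - ρ) * x + ρ * y - x ^ (1 - ρ) * y ^ ρ

theorem meanGap_nonneg (h0 : 0 ≤ ρ) (h1 : ρ ≤ 1) (hx : 0 ≤ x) (hy : 0 ≤ y) :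
    0 ≤ meanGap ρ x y :=
  sub_nonneg.2 (Real.geom_mean_le_arith_mean2_weighted (sub_nonneg.2 h1) h0 hx hy (by ring))

theorem antitoneOn_meanGap_div (hx : 0 ≤ x) (hy : 0 ≤ y) :
    AntitoneOn (fun ρ => meanGap ρ x y / ρ) (Set.Ioc 0 1) := by
  rintro ρ ⟨hρ, -⟩ σ ⟨hσ, hσ1⟩ hρσ
  set θ := ρ / σ with hθ
  have hθσ : θ * σ = ρ := div_mul_cancel₀ ρ hσ.ne'
  have hθ0 : 0 ≤ θ := by positivity
  have hθ1 : θ ≤ 1 := (div_le_one hσ).2 hρσ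
  set m := x ^ (1 - σ) * y ^ σ with hm
  -- The `ρ`-geometric mean of `x` and `y` is the `θ`-geometric mean of `x` and of their
  -- `σ`-geometric mean.
  have hmean : x ^ (1 - ρ) * y ^ ρ = x ^ (1 - θ) * m ^ θ := by
    rw [hm, Real.mul_rpow (by positivity) (by positivity), ← Real.rpow_mul hx, ← Real.rpow_mul hy,
      ← mul_assoc, ← Real.rpow_add_of_nonneg hx (by linarith) (by nlinarith), mul_comm σ, hθσ]
    congr 2
    linear_combination hθσ
  have hamgm := Real.geom_mean_le_arith_mean2_weighted (sub_nonneg.2 hθ1) hθ0 hx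
    (show 0 ≤ m by positivity) (by ring)
  change meanGap σ x y / σ ≤ meanGap ρ x y / ρ
  rw [le_div_iff₀ hρ, div_mul_eq_mul_div, mul_div_assoc, ← hθ, meanGap, meanGap, hmean, ← hθσ]
  linarith

theorem meanGap_div_eq (hρ : ρ ≠ 0) (hx : 0 < x) (hy : 0 ≤ y) :
    meanGap ρ x y / ρ = y - x - x * (ρ⁻¹ * ((y / x) ^ ρ - 1)) := by
  have hmean : x ^ (1 - ρ) * y ^ ρ = x * (y / x) ^ ρ := by
    rw [Real.div_rpow hy hx.le, Real.rpow_sub hx, Real.rpow_one]; field_simp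
  rw [meanGap, hmean]
  field_simp
  ring

theorem tendsto_meanGap_div (hx : 0 ≤ x) (hy : 0 < y) :
    Tendsto (fun ρ => meanGap ρ x y / ρ) (𝓝[>] 0) (𝓝 (y * klFun (x / y))) := by
  rw [mul_klFun_div fun h => absurd h hy.ne']
  rcases hx.eq_or_lt with rfl | hx
  · refine tendsto_const_nhds.congr' ?_
    filter_upwards [Ioo_mem_nhdsGT zero_lt_one] with ρ hρ
    rw [meanGap, Real.zero_rpow (sub_pos.2 hρ.2).ne']
    field_simp [hρ.1.ne']
    ring
  · have hlim := ((tendsto_rpow_sub_one_log (div_pos hy hx)).const_mul x).const_sub (y - x)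
    rw [← inv_div x y, Real.log_inv] at hlim
    convert hlim.congr' ?_ using 2
    · ring
    filter_upwards [self_mem_nhdsWithin] with ρ hρ
    rw [inv_div, meanGap_div_eq (ne_of_gt hρ) hx hy.le]

theorem tendsto_meanGap_div_top (hx : 0 < x) :
    Tendsto (fun ρ => meanGap ρ x 0 / ρ) (𝓝[>] 0) atTop := by
  refine ((tendsto_inv_nhdsGT_zero.atTop_add (tendsto_const_nhds (x := -1))).const_mul_atTop
    hx).congr' ?_
  filter_upwards [self_mem_nhdsWithin] with ρ hρ
  have hρ0 : ρ ≠ 0 := ne_of_gt hρ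
  rw [meanGap, Real.zero_rpow hρ0]
  field_simp
  ring

theorem tendsto_ofReal_meanGap_div (hx : 0 ≤ x) (hy : 0 ≤ y) :
    Tendsto (fun ρ => ENNReal.ofReal (meanGap ρ x y / ρ)) (𝓝[>] 0) (𝓝 (klTerm x y)) := by
  rcases hy.eq_or_lt with rfl | hy
  · rcases hx.eq_or_lt with rfl | hx
    · rw [klTerm_of_ac fun _ => rfl, zero_mul]
      refine tendsto_const_nhds.congr' ?_
      filter_upwards [self_mem_nhdsWithin] with ρ hρ
      simp [meanGap, Real.zero_rpow (ne_of_gt hρ)]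
    · rw [klTerm, if_pos ⟨rfl, hx.ne'⟩]
      exact ENNReal.tendsto_ofReal_atTop.comp (tendsto_meanGap_div_top hx)
  · rw [klTerm_of_ac fun h => absurd h hy.ne']
    exact ENNReal.tendsto_ofReal (tendsto_meanGap_div hx hy)

end MeanGap

section Tsallis

variable {α : Type*} {ρ σ : ℝ}

/-- The Tsallis relative entropy `(1 - ∑ p^(1-ρ) q^ρ) / ρ` of order `1 - ρ`, written as a sum of
nonnegative terms. -/
def tsallisDiv (ρ : ℝ) (p q : PMF α) : ℝ≥0∞ :=
  ∑' a, ENNReal.ofReal (meanGap ρ (p a).toReal (q a).toReal / ρ)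

theorem antitoneOn_tsallisDiv (p q : PMF α) :
    AntitoneOn (fun ρ => tsallisDiv ρ p q) (Set.Ioc 0 1) := fun _ hρ _ hσ h =>
  ENNReal.tsum_le_tsum fun _ => ENNReal.ofReal_le_ofReal
    (antitoneOn_meanGap_div ENNReal.toReal_nonneg ENNReal.toReal_nonneg hρ hσ h)

theorem tsallisDiv_le_kl (hρ : ρ ∈ Set.Ioc 0 1) (p q : PMF α) : tsallisDiv ρ p q ≤ kl p q := by
  rw [kl_eq_tsum]
  refine ENNReal.tsum_le_tsum fun a =>
    ge_of_tendsto (tendsto_ofReal_meanGap_div ENNReal.toReal_nonneg ENNReal.toReal_nonneg) ?_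
  filter_upwards [Ioc_mem_nhdsGT hρ.1] with σ hσ
  exact ENNReal.ofReal_le_ofReal (antitoneOn_meanGap_div ENNReal.toReal_nonneg
    ENNReal.toReal_nonneg ⟨hσ.1, hσ.2.trans hρ.2⟩ hρ hσ.2)

theorem tendsto_tsallisDiv (p q : PMF α) :
    Tendsto (fun ρ => tsallisDiv ρ p q) (𝓝[>] 0) (𝓝 (kl p q)) := by
  refine tendsto_order.2 ⟨fun c hc => ?_, fun c hc => ?_⟩
  · rw [kl_eq_tsum, ENNReal.tsum_eq_iSup_sum] at hc
    obtain ⟨F, hF⟩ := lt_iSup_iff.1 hc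
    have hlim := tendsto_finsetSum F fun a _ => tendsto_ofReal_meanGap_div
      (ENNReal.toReal_nonneg (a := p a)) (ENNReal.toReal_nonneg (a := q a))
    filter_upwards [hlim.eventually (lt_mem_nhds hF)] with ρ hρ
    exact hρ.trans_le (ENNReal.sum_le_tsum F)
  · filter_upwards [Ioc_mem_nhdsGT zero_lt_one] with ρ hρ
    exact (tsallisDiv_le_kl hρ p q).trans_lt hc

/-- The Hellinger affinity (Chernoff coefficient) of order `ρ` of `p` and `q`, which is the base of
the exponential decay in `n` of the probability of confusing two target vectors. -/
def affinity (ρ : ℝ) (p q : PMF α) : ℝ≥0∞ := ∑' a, p a ^ (1 - ρ) * q a ^ ρ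

theorem rpow_mul_rpow_add_meanGap (h0 : 0 < ρ) (h1 : ρ ≤ 1) {x y : ℝ≥0∞} (hx : x ≠ ∞)
    (hy : y ≠ ∞) :
    x ^ (1 - ρ) * y ^ ρ + ENNReal.ofReal ρ * ENNReal.ofReal (meanGap ρ x.toReal y.toReal / ρ) =
      ENNReal.ofReal (1 - ρ) * x + ENNReal.ofReal ρ * y := by
  lift x to ℝ≥0 using hx
  lift y to ℝ≥0 using hy
  have hρ : 0 ≤ 1 - ρ := sub_nonneg.2 h1
  rw [ENNReal.coe_toReal, ENNReal.coe_toReal, ← ENNReal.ofReal_mul h0.le,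
    mul_div_cancel₀ _ h0.ne', ← ENNReal.ofReal_coe_nnreal (p := x),
    ← ENNReal.ofReal_coe_nnreal (p := y), ENNReal.ofReal_rpow_of_nonneg x.coe_nonneg hρ,
    ENNReal.ofReal_rpow_of_nonneg y.coe_nonneg h0.le, ← ENNReal.ofReal_mul (by positivity),
    ← ENNReal.ofReal_mul hρ, ← ENNReal.ofReal_mul h0.le,
    ← ENNReal.ofReal_add (by positivity) (meanGap_nonneg h0.le h1 x.coe_nonneg y.coe_nonneg),
    ← ENNReal.ofReal_add (by positivity) (by positivity), meanGap]
  congr 1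
  ring

theorem affinity_add_tsallisDiv (h0 : 0 < ρ) (h1 : ρ ≤ 1) (p q : PMF α) :
    affinity ρ p q + ENNReal.ofReal ρ * tsallisDiv ρ p q = 1 := by
  rw [affinity, tsallisDiv, ← ENNReal.tsum_mul_left, ← ENNReal.tsum_add,
    tsum_congr fun a => rpow_mul_rpow_add_meanGap h0 h1 (p.apply_ne_top a) (q.apply_ne_top a),
    ENNReal.tsum_add, ENNReal.tsum_mul_left, ENNReal.tsum_mul_left, p.tsum_coe, q.tsum_coe, mul_one,
    mul_one, ← ENNReal.ofReal_add (sub_nonneg.2 h1) h0.le, sub_add_cancel, ENNReal.ofReal_one]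

theorem affinity_le_expNeg (h0 : 0 < ρ) (h1 : ρ ≤ 1) (p q : PMF α) :
    affinity ρ p q ≤ expNeg (ENNReal.ofReal ρ * tsallisDiv ρ p q) :=
  le_expNeg_of_add_le_one (affinity_add_tsallisDiv h0 h1 p q).le

end Tsallis

section Product

variable {α β : Type*}

/-- The product `p ⊗ q` of two discrete distributions. -/
def prodPMF (p : PMF α) (q : PMF β) : PMF (α × β) := p.bind fun a => q.map (Prod.mk a)

theorem bind_map_prodMk_apply (p : PMF α) (κ : α → PMF β) (a : α) (b : β) :
    (p.bind fun a => (κ a).map (Prod.mk a)) (a, b) = p a * κ a b := by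
  have hne : ∀ a', a' ≠ a → p a' * (κ a').map (Prod.mk a') (a, b) = 0 := fun a' h => by
    simp [PMF.map_apply, h.symm]
  rw [PMF.bind_apply, tsum_eq_single a hne, PMF.map_apply,
    tsum_eq_single b fun b' h => if_neg fun heq => h (Prod.mk.inj heq).2.symm, if_pos rfl]

theorem prodPMF_apply (p : PMF α) (q : PMF β) (a : α) (b : β) : prodPMF p q (a, b) = p a * q b :=
  bind_map_prodMk_apply p _ a b

theorem map_fst_apply [Fintype β] (l : PMF (α × β)) (a : α) : l.map Prod.fst a = ∑ b, l (a, b) := by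
  classical
  rw [PMF.map_apply, ENNReal.tsum_prod', tsum_eq_single a fun a' h => by simp [h.symm]]
  simp [tsum_fintype]

theorem map_snd_apply [Fintype α] (l : PMF (α × β)) (b : β) : l.map Prod.snd b = ∑ a, l (a, b) := by
  classical
  rw [PMF.map_apply, ENNReal.tsum_prod', tsum_fintype]
  refine Finset.sum_congr rfl fun a _ => ?_
  rw [tsum_eq_single b fun b' h => by simp [h.symm], if_pos rfl]

theorem apply_eq_zero_of_map_fst (l : PMF (α × β)) {a : α}
    (h : l.map Prod.fst a = 0) (b : β) : l (a, b) = 0 := by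
  rw [PMF.apply_eq_zero_iff, PMF.support_map] at h
  exact (l.apply_eq_zero_iff _).2 fun hab => h ⟨(a, b), hab, rfl⟩

theorem apply_eq_zero_of_map_snd (l : PMF (α × β)) {b : β}
    (h : l.map Prod.snd b = 0) (a : α) : l (a, b) = 0 := by
  rw [PMF.apply_eq_zero_iff, PMF.support_map] at h
  exact (l.apply_eq_zero_iff _).2 fun hab => h ⟨(a, b), hab, rfl⟩

end Product

section Topology

variable {T α β : Type*} [TopologicalSpace T]

/-- The topology of pointwise convergence of probability mass functions. -/
instance instTopologicalSpacePMF : TopologicalSpace (PMF α) :=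
  .induced (fun p a => p a) inferInstance

theorem isEmbedding_coe_pmf : Topology.IsEmbedding fun (p : PMF α) a => p a :=
  ⟨⟨rfl⟩, DFunLike.coe_injective⟩

instance instT2SpacePMF : T2Space (PMF α) := isEmbedding_coe_pmf.t2Space

theorem continuous_pmf_iff {F : T → PMF α} : Continuous F ↔ ∀ a, Continuous fun t => F t a := by
  rw [continuous_induced_rng, continuous_pi_iff]; rfl

theorem continuous_apply_pmf (a : α) : Continuous fun p : PMF α => p a :=
  continuous_pmf_iff.1 continuous_id a

theorem continuous_toReal_apply_pmf (a : α) : Continuous fun p : PMF α => (p a).toReal :=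
  ENNReal.continuousOn_toReal.comp_continuous (continuous_apply_pmf a) fun p => p.apply_ne_top a

instance instCompactSpacePMF [Finite α] : CompactSpace (PMF α) := by
  have := Fintype.ofFinite α
  have hrange : (fun (p : PMF α) a => p a) '' Set.univ = {f : α → ℝ≥0∞ | ∑ a, f a = 1} := by
    ext f
    refine ⟨?_, fun hf => ⟨PMF.ofFintype f hf, trivial, rfl⟩⟩
    rintro ⟨p, -, rfl⟩
    exact sum_coe_eq_one p
  refine ⟨isEmbedding_coe_pmf.isInducing.isCompact_iff.2 ?_⟩
  rw [hrange]
  exact (isClosed_eq (continuous_finsetSum _ fun a _ => continuous_apply a)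
    continuous_const).isCompact

theorem continuous_pmf_bind [Finite α] (κ : α → PMF β) : Continuous fun p : PMF α => p.bind κ := by
  have := Fintype.ofFinite α
  refine continuous_pmf_iff.2 fun b => ?_
  simp only [PMF.bind_apply, tsum_fintype]
  exact continuous_finsetSum _ fun a _ =>
    (ENNReal.continuous_mul_const ((κ a).apply_ne_top b)).comp (continuous_apply_pmf a)

theorem continuous_pmf_map [Finite α] (f : α → β) : Continuous fun p : PMF α => p.map f :=
  continuous_pmf_bind _

theorem continuous_iid [Fintype α] (n : ℕ) : Continuous fun p : PMF α => iid n p := by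
  refine continuous_pmf_iff.2 fun w => ?_
  have hprod : ∀ p : PMF α, iid n p w = ENNReal.ofReal (∏ u, (p (w u)).toReal) := fun p => by
    rw [← ENNReal.toReal_prod, ENNReal.ofReal_toReal (ENNReal.prod_ne_top fun u _ =>
      p.apply_ne_top _)]
    rfl
  simp only [hprod]
  exact ENNReal.continuous_ofReal.comp
    (continuous_finsetProd _ fun u _ => continuous_toReal_apply_pmf _)

theorem lowerSemicontinuous_tsallisDiv {ρ : ℝ} (hρ : ρ ∈ Set.Ioc 0 1) {F G : T → PMF α}
    (hF : Continuous F) (hG : Continuous G) :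
    LowerSemicontinuous fun t => tsallisDiv ρ (F t) (G t) := by
  refine lowerSemicontinuous_tsum fun a => Continuous.lowerSemicontinuous ?_
  have hf := (continuous_toReal_apply_pmf a).comp hF
  have hg := (continuous_toReal_apply_pmf a).comp hG
  exact ENNReal.continuous_ofReal.comp ((((hf.const_mul _).add (hg.const_mul _)).sub
    ((hf.rpow_const fun _ => Or.inr (sub_nonneg.2 hρ.2)).mul
      (hg.rpow_const fun _ => Or.inr hρ.1.le))).div_const ρ)

theorem lowerSemicontinuous_kl {F G : T → PMF α} (hF : Continuous F) (hG : Continuous G) :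
    LowerSemicontinuous fun t => kl (F t) (G t) := by
  intro t c hc
  obtain ⟨ρ, hcρ, hρ⟩ := (((tendsto_tsallisDiv (F t) (G t)).eventually (lt_mem_nhds hc)).and
    (Ioc_mem_nhdsGT zero_lt_one)).exists
  filter_upwards [lowerSemicontinuous_tsallisDiv hρ hF hG t c hcρ] with t' ht'
  exact ht'.trans_le (tsallisDiv_le_kl hρ _ _)

end Topology

section Iid

variable {α β : Type*}

theorem tsum_pi_prod : ∀ {n : ℕ} (g : Fin n → α → ℝ≥0∞),
    ∑' f : Fin n → α, ∏ i, g i (f i) = ∏ i, ∑' a, g i a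
  | 0, g => by
    rw [tsum_eq_single (fun i => Fin.elim0 i) fun f hf => (hf (Subsingleton.elim _ _)).elim]
    simp
  | n + 1, g => by
    rw [← (Fin.consEquiv fun _ => α).tsum_eq, ENNReal.tsum_prod', Fin.prod_univ_succ]
    simp only [Fin.consEquiv, Equiv.coe_fn_mk, Fin.prod_univ_succ, Fin.cons_zero, Fin.cons_succ]
    simp_rw [ENNReal.tsum_mul_left, tsum_pi_prod fun i => g i.succ, ENNReal.tsum_mul_right]

theorem tsum_prod_rpow_mul_prod_rpow {n : ℕ} {ρ : ℝ} (hρ : ρ ∈ Set.Ioc 0 1) (p q : PMF α) :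
    ∑' z : Fin n → α, (∏ i, p (z i)) ^ (1 - ρ) * (∏ i, q (z i)) ^ ρ = affinity ρ p q ^ n := by
  simp only [← ENNReal.prod_rpow_of_nonneg hρ.1.le,
    ← ENNReal.prod_rpow_of_nonneg (sub_nonneg.2 hρ.2), ← Finset.prod_mul_distrib]
  rw [tsum_pi_prod fun _ a => p a ^ (1 - ρ) * q a ^ ρ, Finset.prod_const, Finset.card_univ,
    Fintype.card_fin, affinity]

theorem iid_apply [Fintype α] (n : ℕ) (p : PMF α) (w : Fin n → α) : iid n p w = ∏ u, p (w u) := rfl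

theorem sum_iid_mul_prod [Fintype α] {n : ℕ} (p : PMF α) (f : Fin n → α → ℝ≥0∞) :
    ∑ w, iid n p w * ∏ u, f u (w u) = ∏ u, ∑ a, p a * f u a := by
  classical
  simp only [iid_apply, ← Finset.prod_mul_distrib]
  exact (Fintype.prod_sum fun u a => p a * f u a).symm

theorem iid_map [Fintype α] [Fintype β] (n : ℕ) (p : PMF α) (f : α → β) :
    iid n (p.map f) = (iid n p).map fun w u => f (w u) := by
  classical
  ext w
  rw [iid_apply, PMF.map_apply, tsum_fintype]
  simp only [PMF.map_apply, tsum_fintype]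
  rw [Fintype.prod_sum]
  refine Finset.sum_congr rfl fun τ _ => ?_
  rw [Finset.prod_ite_zero]
  simp [funext_iff, iid_apply]

end Iid

section Empirical

variable {α β : Type*} {k : ℕ} [NeZero k]

/-- The empirical distribution, or type, of a word. -/
def empirical (z : Fin k → α) : PMF α := (PMF.uniformOfFintype (Fin k)).map z

theorem map_empirical (z : Fin k → α) (f : α → β) :
    (empirical z).map f = empirical fun t => f (z t) :=
  PMF.map_comp z _ f

theorem empirical_apply [DecidableEq α] (z : Fin k → α) (a : α) :
    empirical z a = (Finset.univ.filter fun t => a = z t).card / k := by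
  rw [empirical, PMF.map_apply, tsum_fintype]
  simp only [PMF.uniformOfFintype_apply, Fintype.card_fin]
  rw [Finset.card_filter, Nat.cast_sum, div_eq_mul_inv, Finset.sum_mul]
  exact Finset.sum_congr rfl fun t _ => by split_ifs <;> simp

theorem empirical_apply_ne_zero (z : Fin k → α) (t : Fin k) : empirical z (z t) ≠ 0 := by
  rw [← PMF.mem_support_iff, empirical, PMF.mem_support_map_iff]
  exact ⟨t, by simp, rfl⟩

theorem empirical_apply_eq_zero {z : Fin k → α} {a : α} (h : ∀ t, z t ≠ a) : empirical z a = 0 := by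
  rw [PMF.apply_eq_zero_iff, empirical, PMF.mem_support_map_iff]
  exact fun ⟨t, _, ht⟩ => h t ht

theorem sum_comp_eq_mul_sum_empirical [Fintype α] (z : Fin k → α) (f : α → ℝ) :
    ∑ t, f (z t) = k * ∑ a, (empirical z a).toReal * f a := by
  rw [empirical, sum_map_toReal_mul]
  simp [Finset.mul_sum, mul_inv_cancel_left₀ (NeZero.ne (k : ℝ))]

theorem prod_eq_expNeg_mul_prod_empirical [Finite α] (q : PMF α) (z : Fin k → α) :
    ∏ t, q (z t) = expNeg (k * kl (empirical z) q) * ∏ t, empirical z (z t) := by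
  have := Fintype.ofFinite α
  set p := empirical z
  by_cases hac : ∀ a, q a = 0 → p a = 0
  · set f : α → ℝ := fun a => Real.log ((p a).toReal / (q a).toReal)
    have hpos : ∀ t, 0 < (p (z t)).toReal ∧ 0 < (q (z t)).toReal := fun t =>
      have ht : p (z t) ≠ 0 := empirical_apply_ne_zero z t
      ⟨ENNReal.toReal_pos ht (p.apply_ne_top _),
        ENNReal.toReal_pos (mt (hac _) ht) (q.apply_ne_top _)⟩
    have hq : ∀ t, q (z t) = ENNReal.ofReal (Real.exp (-f (z t))) * p (z t) := fun t => by
      rw [← Real.log_inv, inv_div, Real.exp_log (div_pos (hpos t).2 (hpos t).1),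
        ENNReal.ofReal_div_of_pos (hpos t).1, ENNReal.ofReal_toReal (p.apply_ne_top _),
        ENNReal.ofReal_toReal (q.apply_ne_top _), ENNReal.div_mul_cancel
          (empirical_apply_ne_zero z t) (p.apply_ne_top _)]
    rw [Finset.prod_congr rfl fun t _ => hq t, Finset.prod_mul_distrib,
      ← ENNReal.ofReal_prod_of_nonneg fun t _ => (Real.exp_pos _).le, ← Real.exp_sum,
      Finset.sum_neg_distrib, sum_comp_eq_mul_sum_empirical z f, kl_eq_ofReal_sum hac,
      ← ENNReal.ofReal_natCast k, ← ENNReal.ofReal_mul k.cast_nonneg,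
      expNeg_ofReal (mul_nonneg k.cast_nonneg (sum_mul_log_div_nonneg hac))]
  · push Not at hac
    obtain ⟨a, hqa, hpa⟩ := hac
    obtain ⟨t, rfl⟩ : ∃ t, z t = a := by
      by_contra! h
      exact hpa (empirical_apply_eq_zero h)
    rw [kl_eq_top hqa hpa, ENNReal.mul_top (NeZero.ne _), expNeg_top, zero_mul]
    exact Finset.prod_eq_zero (Finset.mem_univ t) hqa

variable [Fintype α]

variable (α k) in
/-- The types of words of length `k` over the alphabet `α`. -/
def types : Finset (PMF α) :=
  open Classical in Finset.univ.image (empirical : (Fin k → α) → PMF α)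

theorem empirical_mem_types (z : Fin k → α) : empirical z ∈ types α k := by
  classical
  exact Finset.mem_image_of_mem _ (Finset.mem_univ z)

variable (α k) in
theorem card_types_le : (types α k).card ≤ (k + 1) ^ Fintype.card α := by
  classical
  set freq : Finset ℝ≥0∞ := (Finset.range (k + 1)).image fun j : ℕ => (j : ℝ≥0∞) / k
  have hmaps : ∀ p ∈ types α k, ⇑p ∈ Fintype.piFinset fun _ : α => freq := by
    simp only [types, Finset.mem_image, Fintype.mem_piFinset]
    rintro _ ⟨z, -, rfl⟩ a
    rw [empirical_apply]
    refine Finset.mem_image_of_mem _ (Finset.mem_range_succ_iff.2 ?_)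
    exact (Finset.card_filter_le _ _).trans_eq (Finset.card_fin k)
  calc (types α k).card ≤ (Fintype.piFinset fun _ : α => freq).card :=
        Finset.card_le_card_of_injOn _ hmaps DFunLike.coe_injective.injOn
    _ = freq.card ^ Fintype.card α := by simp
    _ ≤ (k + 1) ^ Fintype.card α := by
        gcongr
        exact Finset.card_image_le.trans_eq (Finset.card_range _)

open Classical in
theorem sum_prod_typeClass_le (p γ : PMF α) :
    ∑ z : Fin k → α with empirical z = γ, ∏ t, p (z t) ≤ expNeg (k * kl γ p) := by
  calc ∑ z : Fin k → α with empirical z = γ, ∏ t, p (z t)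
      = ∑ z : Fin k → α with empirical z = γ, expNeg (k * kl γ p) * ∏ t, γ (z t) := by
        refine Finset.sum_congr rfl fun z hz => ?_
        rw [prod_eq_expNeg_mul_prod_empirical, (Finset.mem_filter.1 hz).2]
    _ ≤ ∑ z : Fin k → α, expNeg (k * kl γ p) * iid k γ z :=
        Finset.sum_le_sum_of_subset (Finset.filter_subset _ _)
    _ = expNeg (k * kl γ p) := by rw [← Finset.mul_sum, sum_coe_eq_one, mul_one]

open Classical in
theorem sum_prod_kl_gt_le (p : PMF α) (δ : ℝ≥0∞) :
    ∑ z : Fin k → α with δ < kl (empirical z) p, ∏ t, p (z t) ≤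
      ((k : ℝ≥0∞) + 1) ^ Fintype.card α * expNeg (k * δ) := by
  rw [← Finset.sum_fiberwise_of_maps_to (t := types α k) fun z _ => empirical_mem_types z]
  refine (Finset.sum_le_card_nsmul _ _ (expNeg (k * δ)) fun γ _ => ?_).trans ?_
  · rw [Finset.filter_filter]
    by_cases hγ : δ < kl γ p
    · calc _ ≤ ∑ z : Fin k → α with empirical z = γ, ∏ t, p (z t) :=
            Finset.sum_le_sum_of_subset (Finset.monotone_filter_right _ fun _ _ => And.right)
        _ ≤ expNeg (k * kl γ p) := sum_prod_typeClass_le p γ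
        _ ≤ expNeg (k * δ) := expNeg_antitone (by gcongr)
    · rw [Finset.filter_false_of_mem fun z _ ⟨hδ, hz⟩ => hγ (hz ▸ hδ), Finset.sum_empty]
      exact zero_le
  · rw [nsmul_eq_mul]
    gcongr
    exact_mod_cast card_types_le α k

open Classical in
theorem sum_prod_condTypeClass_le [Fintype β] (p : PMF β) (v : Fin k → α) (l : PMF (α × β)) :
    ∑ w : Fin k → β with empirical (fun t => (v t, w t)) = l, ∏ t, p (w t) ≤
      expNeg (k * kl l (prodPMF (l.map Prod.fst) p)) := by
  set S := Finset.univ.filter fun w : Fin k → β => empirical (fun t => (v t, w t)) = l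
  set γ := l.map Prod.fst with hγ
  rcases S.eq_empty_or_nonempty with hempty | ⟨w₀, hw₀⟩
  · simp [hempty]
  have hv : γ = empirical v := by rw [hγ, ← (Finset.mem_filter.1 hw₀).2, map_empirical]
  have hne : ∏ t, γ (v t) ≠ 0 :=
    Finset.prod_ne_zero_iff.2 fun t _ => hv ▸ empirical_apply_ne_zero v t
  have htop : ∏ t, γ (v t) ≠ ∞ := ENNReal.prod_ne_top fun t _ => γ.apply_ne_top _
  rw [← ENNReal.mul_le_mul_iff_right hne htop, mul_comm _ (expNeg _)]
  calc (∏ t, γ (v t)) * ∑ w ∈ S, ∏ t, p (w t)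
      = ∑ w ∈ S, expNeg (k * kl l (prodPMF γ p)) * ∏ t, l (v t, w t) := by
        rw [Finset.mul_sum]
        refine Finset.sum_congr rfl fun w hw => ?_
        rw [← Finset.prod_mul_distrib, Finset.prod_congr rfl fun t _ => (prodPMF_apply ..).symm,
          prod_eq_expNeg_mul_prod_empirical _ fun t => (v t, w t), (Finset.mem_filter.1 hw).2]
    _ ≤ ∑ w : Fin k → β, expNeg (k * kl l (prodPMF γ p)) * ∏ t, l (v t, w t) :=
        Finset.sum_le_sum_of_subset (Finset.subset_univ _)
    _ = expNeg (k * kl l (prodPMF γ p)) * ∏ t, γ (v t) := by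
        rw [← Finset.mul_sum]
        simp only [hγ, map_fst_apply, Fintype.prod_sum]

end Empirical

section CrossEntropy

variable {α β : Type*}

theorem neg_log_toReal_nonneg (p : PMF α) (a : α) : 0 ≤ -Real.log (p a).toReal :=
  neg_nonneg.2 (Real.log_nonpos ENNReal.toReal_nonneg
    (ENNReal.toReal_mono ENNReal.one_ne_top (p.coe_le_one a)))

theorem relEntropy_eq_kl_div (p q : PMF α) :
    relEntropy p q = kl p q / ENNReal.ofReal (Real.log 2) := rfl

theorem coe_relEntropy_eq_top {p q : PMF α} {a : α} (hq : q a = 0) (hp : p a ≠ 0) :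
    (relEntropy p q : EReal) = ⊤ := by
  rw [relEntropy_eq_kl_div, kl_eq_top hq hp, ENNReal.top_div_of_ne_top ENNReal.ofReal_ne_top,
    EReal.coe_ennreal_top]

variable [Fintype α] [Fintype β]

/-- The cross entropy `-∑ p log q`, in nats; a letter with `q a = 0` contributes nothing, since
`Real.log 0 = 0`. -/
def crossEntropy (p q : PMF α) : ℝ := ∑ a, (p a).toReal * -Real.log (q a).toReal

theorem crossEntropy_nonneg (p q : PMF α) : 0 ≤ crossEntropy p q :=
  Finset.sum_nonneg fun a _ => mul_nonneg ENNReal.toReal_nonneg (neg_log_toReal_nonneg q a)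

theorem crossEntropy_le_sum (p q : PMF α) : crossEntropy p q ≤ ∑ a, -Real.log (q a).toReal :=
  Finset.sum_le_sum fun a _ => mul_le_of_le_one_left (neg_log_toReal_nonneg q a)
    (ENNReal.toReal_mono ENNReal.one_ne_top (p.coe_le_one a))

theorem continuous_crossEntropy_left (q : PMF α) : Continuous fun p => crossEntropy p q :=
  continuous_finsetSum _ fun a _ => (continuous_toReal_apply_pmf a).mul_const _

theorem entropy_eq_crossEntropy_div (p : PMF α) : entropy p = crossEntropy p p / Real.log 2 := by
  simp only [entropy, crossEntropy, Real.negMulLog, neg_mul, mul_neg]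

theorem sum_mul_log_div_eq {p q : PMF α} (h : ∀ a, q a = 0 → p a = 0) :
    ∑ a, (p a).toReal * Real.log ((p a).toReal / (q a).toReal) =
      crossEntropy p q - crossEntropy p p := by
  rw [crossEntropy, crossEntropy, ← Finset.sum_sub_distrib]
  refine Finset.sum_congr rfl fun a _ => ?_
  rcases eq_or_ne (p a) 0 with hp | hp
  · simp [hp]
  · rw [Real.log_div (ENNReal.toReal_ne_zero.2 ⟨hp, p.apply_ne_top a⟩)
      (ENNReal.toReal_ne_zero.2 ⟨mt (h a) hp, q.apply_ne_top a⟩)]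
    ring

theorem log_two_pos : 0 < Real.log 2 := Real.log_pos one_lt_two

theorem coe_relEntropy {p q : PMF α} (h : ∀ a, q a = 0 → p a = 0) :
    (relEntropy p q : EReal) = ((crossEntropy p q / Real.log 2 - entropy p : ℝ) : EReal) := by
  have hnn := sum_mul_log_div_nonneg h
  rw [sum_mul_log_div_eq h] at hnn
  rw [relEntropy_eq_kl_div, kl_eq_ofReal_sum h, sum_mul_log_div_eq h,
    ← ENNReal.ofReal_div_of_pos log_two_pos, EReal.coe_ennreal_ofReal,
    max_eq_left (div_nonneg hnn log_two_pos.le), sub_div, entropy_eq_crossEntropy_div]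

theorem crossEntropy_prodPMF (l : PMF (α × β)) {q : PMF β}
    (h : ∀ b, q b = 0 → l.map Prod.snd b = 0) :
    crossEntropy l (prodPMF (l.map Prod.fst) q) =
      crossEntropy (l.map Prod.fst) (l.map Prod.fst) + crossEntropy (l.map Prod.snd) q := by
  simp only [crossEntropy]
  rw [sum_map_toReal_mul, sum_map_toReal_mul l Prod.snd, ← Finset.sum_add_distrib]
  refine Finset.sum_congr rfl fun ⟨a, b⟩ _ => ?_
  rcases eq_or_ne (l (a, b)) 0 with hl | hl
  · simp [hl]
  have ha := mt (fun h0 => apply_eq_zero_of_map_fst l h0 b) hl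
  have hb := mt (fun h0 => apply_eq_zero_of_map_snd l (h b h0) a) hl
  rw [prodPMF_apply, ENNReal.toReal_mul,
    Real.log_mul (ENNReal.toReal_ne_zero.2 ⟨ha, PMF.apply_ne_top _ _⟩)
      (ENNReal.toReal_ne_zero.2 ⟨hb, PMF.apply_ne_top _ _⟩)]
  ring

-- Both sides are `-∞` when the second marginal is not absolutely continuous with respect to `q`.
theorem entropy_sub_relEntropy_map_snd (l : PMF (α × β)) (q : PMF β) :
    ((entropy l - entropy (l.map Prod.snd) : ℝ) : EReal) - (relEntropy (l.map Prod.snd) q : EReal) =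
      (entropy (l.map Prod.fst) : EReal) - (relEntropy l (prodPMF (l.map Prod.fst) q) : EReal) := by
  by_cases h : ∀ b, q b = 0 → l.map Prod.snd b = 0
  · have hprod : ∀ x, prodPMF (l.map Prod.fst) q x = 0 → l x = 0 := by
      rintro ⟨a, b⟩ hx
      rw [prodPMF_apply, mul_eq_zero] at hx
      exact hx.elim (fun ha => apply_eq_zero_of_map_fst l ha b)
        fun hb => apply_eq_zero_of_map_snd l (h b hb) a
    rw [coe_relEntropy h, coe_relEntropy hprod, crossEntropy_prodPMF l h, ← EReal.coe_sub,
      ← EReal.coe_sub, add_div, ← entropy_eq_crossEntropy_div]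
    congr 1
    ring
  · push Not at h
    obtain ⟨b, hb, hlb⟩ := h
    obtain ⟨a, ha⟩ : ∃ a, l (a, b) ≠ 0 := by
      by_contra! h0
      exact hlb (by rw [map_snd_apply, Finset.sum_eq_zero fun a _ => h0 a])
    rw [coe_relEntropy_eq_top hb hlb,
      coe_relEntropy_eq_top (by rw [prodPMF_apply, hb, mul_zero]) ha, EReal.sub_top, EReal.sub_top]

end CrossEntropy

namespace Model

variable {V X Y : Type*} [Fintype V] (M : Model V X Y)

theorem denominator_eq {l : PMF (V × V)} (h : l.map Prod.fst = M.prior) :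
    M.denominator l =
      (entropy M.prior : EReal) - (relEntropy l (prodPMF M.prior M.prior) : EReal) := by
  rw [denominator, entropy_sub_relEntropy_map_snd, h]

theorem lt_quotient_iff_mul_denominator_lt (l : PMF (V × V)) {r : ℝ} (hr : 0 < r) :
    ENNReal.ofReal r < M.quotient l ↔
      (r : EReal) * M.denominator l < (relEntropy (M.lawP M.prior) (M.lawQ l) : EReal) := by
  have hr' : (0 : EReal) < r := EReal.coe_pos.2 hr
  rcases lt_or_ge (M.denominator l) 0 with hneg | hnonneg
  · rw [quotient, if_pos hneg]
    exact iff_of_true ENNReal.ofReal_lt_top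
      ((EReal.mul_neg_iff.2 (.inl ⟨hr', hneg⟩)).trans_le (EReal.coe_ennreal_nonneg _))
  · have htop : M.denominator l ≠ ⊤ := ne_top_of_le_ne_top (EReal.coe_ne_top _)
      (EReal.sub_le_of_le_add (le_add_of_nonneg_right (EReal.coe_ennreal_nonneg _)))
    have hfin : (M.denominator l).toENNReal ≠ ∞ := EReal.toENNReal_ne_top_iff.2 htop
    rw [quotient, if_neg hnonneg.not_gt,
      ENNReal.lt_div_iff_mul_lt (.inr ENNReal.ofReal_ne_top) (.inl hfin),
      ← EReal.coe_ennreal_lt_coe_ennreal_iff, EReal.coe_ennreal_mul, EReal.coe_ennreal_ofReal,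
      max_eq_left hr.le, EReal.coe_toENNReal hnonneg]

theorem lt_quotient_iff {l : PMF (V × V)} (h : l.map Prod.fst = M.prior) {r : ℝ} (hr : 0 < r) :
    ENNReal.ofReal r < M.quotient l ↔ ENNReal.ofReal (r * crossEntropy M.prior M.prior) <
      ENNReal.ofReal r * kl l (prodPMF M.prior M.prior) + kl (M.lawP M.prior) (M.lawQ l) := by
  have hL := log_two_pos
  have hH : 0 ≤ crossEntropy M.prior M.prior := crossEntropy_nonneg _ _
  rw [M.lt_quotient_iff_mul_denominator_lt l hr, M.denominator_eq h, entropy_eq_crossEntropy_div,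
    relEntropy_eq_kl_div, relEntropy_eq_kl_div]
  generalize kl l _ = K, kl (M.lawP M.prior) _ = N, crossEntropy M.prior M.prior = H at hH
  have htop : ∞ / ENNReal.ofReal (Real.log 2) = ∞ := ENNReal.top_div_of_ne_top ENNReal.ofReal_ne_top
  rcases eq_or_ne K ∞ with rfl | hK
  · rw [htop, EReal.coe_ennreal_top, EReal.sub_top, EReal.coe_mul_bot_of_pos hr,
      ENNReal.mul_top (ENNReal.ofReal_pos.2 hr).ne', top_add]
    exact iff_of_true (EReal.bot_lt_zero.trans_le (EReal.coe_ennreal_nonneg _))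
      ENNReal.ofReal_lt_top
  obtain ⟨x, hx, rfl⟩ : ∃ x : ℝ, 0 ≤ x ∧ K = ENNReal.ofReal x :=
    ⟨_, ENNReal.toReal_nonneg, (ENNReal.ofReal_toReal hK).symm⟩
  rw [← ENNReal.ofReal_div_of_pos hL, EReal.coe_ennreal_ofReal, max_eq_left (by positivity),
    ← EReal.coe_sub, ← EReal.coe_mul, ← ENNReal.ofReal_mul hr.le]
  rcases eq_or_ne N ∞ with rfl | hN
  · rw [htop, EReal.coe_ennreal_top, add_top]
    exact iff_of_true (EReal.coe_lt_top _) ENNReal.ofReal_lt_top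
  obtain ⟨y, hy, rfl⟩ : ∃ y : ℝ, 0 ≤ y ∧ N = ENNReal.ofReal y :=
    ⟨_, ENNReal.toReal_nonneg, (ENNReal.ofReal_toReal hN).symm⟩
  rw [← ENNReal.ofReal_div_of_pos hL, EReal.coe_ennreal_ofReal, max_eq_left (by positivity),
    EReal.coe_lt_coe_iff, ← sub_div, ← mul_div_assoc, div_lt_div_iff_of_pos_right hL,
    ← ENNReal.ofReal_add (by positivity) hy, ENNReal.ofReal_lt_ofReal_iff_of_nonneg (by positivity),
    mul_sub, sub_lt_iff_lt_add']

end Model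

section Compactness

theorem isOpen_setOf_lt_of_lowerSemicontinuous {T : Type*} [TopologicalSpace T] {f g : T → ℝ≥0∞}
    (hf : Continuous f) (hg : LowerSemicontinuous g) : IsOpen {t | f t < g t} := by
  refine isOpen_iff_mem_nhds.2 fun t ht => ?_
  obtain ⟨c, hfc, hcg⟩ := exists_between (show f t < g t from ht)
  filter_upwards [hf.continuousAt.eventually_lt_const hfc, hg t c hcg] with s hs hs'
  exact hs.trans hs'

end Compactness

namespace Model

variable {V X Y : Type*} [Fintype V] (M : Model V X Y)

theorem continuous_lawP : Continuous M.lawP := by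
  have h (γ : PMF V) : M.lawP γ =
      (iid M.c γ).bind fun a => (M.noise (M.Ψ a)).map (Prod.mk (M.Ψ a)) := by
    rw [lawP, outputLaw, PMF.bind_map]; rfl
  rw [funext h]
  exact (continuous_pmf_bind _).comp (continuous_iid _)

theorem continuous_lawQ : Continuous M.lawQ := by
  have h (l : PMF (V × V)) : M.lawQ l =
      (iid M.c l).bind fun w => (M.noise (M.Ψ fun u => (w u).2)).map
        (Prod.mk (M.Ψ fun u => (w u).1)) := by
    rw [lawQ, jointOutputLaw, PMF.bind_map]; rfl
  rw [funext h]
  exact (continuous_pmf_bind _).comp (continuous_iid _)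

/-- The joint laws `l` for which, with slack `ρ`, a target vector of type `γ = l.map Prod.fst` is
either atypical or, at rate `R` and with Gallager parameter `ρ`, unlikely to be confused with the
target vectors of joint type `l` with it. -/
def separated (R ρ : ℝ) : Set (PMF (V × V)) :=
  {l | ENNReal.ofReal ρ < kl (l.map Prod.fst) M.prior ∨
    ENNReal.ofReal (R * crossEntropy (l.map Prod.fst) M.prior + ρ) <
      ENNReal.ofReal R * kl l (prodPMF (l.map Prod.fst) M.prior) +
        tsallisDiv ρ (M.lawP (l.map Prod.fst)) (M.lawQ l)}

theorem isOpen_separated {R ρ : ℝ} (hρ : ρ ∈ Set.Ioc 0 1) : IsOpen (M.separated R ρ) := by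
  have hfst : Continuous fun l : PMF (V × V) => l.map Prod.fst := continuous_pmf_map _
  refine ((lowerSemicontinuous_kl hfst continuous_const).isOpen_preimage _).union
    (isOpen_setOf_lt_of_lowerSemicontinuous ?_ ?_)
  · exact ENNReal.continuous_ofReal.comp
      ((((continuous_crossEntropy_left _).comp hfst).const_mul R).add_const ρ)
  · exact ((ENNReal.continuous_const_mul ENNReal.ofReal_ne_top).comp_lowerSemicontinuous
      (lowerSemicontinuous_kl continuous_id ((continuous_pmf_bind _).comp hfst))
        fun _ _ h => by gcongr).add
      (lowerSemicontinuous_tsallisDiv hρ (M.continuous_lawP.comp hfst) M.continuous_lawQ)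

theorem antitoneOn_separated (R : ℝ) : AntitoneOn (M.separated R) (Set.Ioc 0 1) := by
  rintro ρ hρ σ hσ h l (hl | hl)
  · exact .inl ((ENNReal.ofReal_le_ofReal h).trans_lt hl)
  · refine .inr (lt_of_le_of_lt (by gcongr) (hl.trans_le ?_))
    gcongr
    exact antitoneOn_tsallisDiv _ _ hρ hσ h

theorem eventually_mem_separated {R : ℝ} (hR : 0 < R) {l : PMF (V × V)}
    (h : l.map Prod.fst = M.prior → ENNReal.ofReal R < M.quotient l) :
    ∀ᶠ ρ in 𝓝[>] 0, l ∈ M.separated R ρ := by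
  have hofReal : Tendsto ENNReal.ofReal (𝓝[>] 0) (𝓝 0) := by
    simpa using (ENNReal.continuous_ofReal.tendsto 0).mono_left nhdsWithin_le_nhds
  by_cases hl : l.map Prod.fst = M.prior
  · have hleft : Tendsto (fun ρ => ENNReal.ofReal (R * crossEntropy M.prior M.prior + ρ)) (𝓝[>] 0)
        (𝓝 (ENNReal.ofReal (R * crossEntropy M.prior M.prior))) := by
      refine ENNReal.tendsto_ofReal (Tendsto.mono_left ?_ nhdsWithin_le_nhds)
      simpa using (continuous_const_add (R * crossEntropy M.prior M.prior)).tendsto 0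
    filter_upwards [hleft.eventually_lt ((tendsto_tsallisDiv _ _).const_add _)
      ((M.lt_quotient_iff hl hR).1 (h hl))] with ρ hρ
    exact .inr (by rwa [hl])
  · filter_upwards [hofReal.eventually_lt_const
      (pos_iff_ne_zero.2 (mt kl_eq_zero_iff.1 hl))] with ρ hρ
    exact .inl hρ

variable [DecidableEq V]

/-- The probability that the two coordinates of a pair with law `l` differ. -/
def offDiagMass (l : PMF (V × V)) : ℝ≥0∞ := ∑ p : V × V, if p.1 ≠ p.2 then l p else 0

theorem continuous_offDiagMass : Continuous (offDiagMass : PMF (V × V) → ℝ≥0∞) :=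
  continuous_finsetSum _ fun p _ => by
    split_ifs
    exacts [continuous_apply_pmf p, continuous_const]

theorem isCompact_feasible (D : ℝ) : IsCompact (M.feasible D) :=
  ((isClosed_eq (continuous_pmf_map _) continuous_const).inter
    (isClosed_le continuous_const continuous_offDiagMass)).isCompact

theorem lowerSemicontinuousOn_quotient (D : ℝ) :
    LowerSemicontinuousOn M.quotient (M.feasible D) := by
  intro l hl c hc
  obtain ⟨r, -, hcr, hrl⟩ := ENNReal.lt_iff_exists_real_btwn.1 hc
  have hr : 0 < r := ENNReal.ofReal_pos.1 (bot_le.trans_lt hcr)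
  have hlsc : LowerSemicontinuous fun l : PMF (V × V) =>
      ENNReal.ofReal r * kl l (prodPMF M.prior M.prior) + kl (M.lawP M.prior) (M.lawQ l) :=
    ((ENNReal.continuous_const_mul ENNReal.ofReal_ne_top).comp_lowerSemicontinuous
      (lowerSemicontinuous_kl continuous_id continuous_const) fun _ _ h => by gcongr).add
        (lowerSemicontinuous_kl continuous_const M.continuous_lawQ)
  filter_upwards [nhdsWithin_le_nhds (hlsc l _ ((M.lt_quotient_iff hl.1 hr).1 hrl)),
    self_mem_nhdsWithin] with l' hlt hl'
  exact hcr.trans ((M.lt_quotient_iff hl'.1 hr).2 hlt)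

theorem exists_quotient_eq_lowerBound {D : ℝ} (h : (M.feasible D).Nonempty) :
    ∃ l ∈ M.feasible D, M.quotient l = M.lowerBound D := by
  obtain ⟨l, hl, hmin⟩ := (M.lowerSemicontinuousOn_quotient D).exists_isMinOn h
    (M.isCompact_feasible D)
  exact ⟨l, hl, le_antisymm (le_iInf₂ fun _ h' => hmin h') (iInf₂_le l hl)⟩

theorem exists_forall_mem_separated {D R : ℝ} (hR : 0 < R)
    (h : ENNReal.ofReal R < M.lowerBound D) :
    ∃ ρ ∈ Set.Ioc 0 1, ∀ l, ENNReal.ofReal D ≤ offDiagMass l → l ∈ M.separated R ρ := by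
  have hcompact : IsCompact {l : PMF (V × V) | ENNReal.ofReal D ≤ offDiagMass l} :=
    (isClosed_le continuous_const continuous_offDiagMass).isCompact
  obtain ⟨⟨ρ, hρ⟩, hsub⟩ := hcompact.elim_directed_cover
    (fun ρ : Set.Ioc (0 : ℝ) 1 => M.separated R ρ) (fun ρ => M.isOpen_separated ρ.2)
    (fun l hl => by
      obtain ⟨ρ, hlρ, hρ⟩ := ((M.eventually_mem_separated hR fun hfst =>
        h.trans_le (iInf₂_le l ⟨hfst, hl⟩)).and (Ioc_mem_nhdsGT zero_lt_one)).exists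
      exact Set.mem_iUnion.2 ⟨⟨ρ, hρ⟩, hlρ⟩)
    (Antitone.directed_le fun ρ σ hle => M.antitoneOn_separated R ρ.2 σ.2 hle)
  exact ⟨ρ, hρ, fun l hl => hsub hl⟩

end Model

/-- The random network whose connections are independent and uniform over the target positions. -/
def randomNetwork (c k n : ℕ) [NeZero k] : PMF (Network c k n) :=
  iid n (iid c (PMF.uniformOfFintype (Fin k)))

namespace Model

variable {V X Y : Type*} (M : Model V X Y) {k n : ℕ}

/-- The joint law of the ideal output for the target vector `v` of a sensor with connections `τ`,
and of an output observed when the target vector is `w`. -/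
def sensorLaw (v w : Fin k → V) (τ : Fin M.c → Fin k) : PMF (X × Y) :=
  (M.noise (M.Ψ fun u => w (τ u))).map (Prod.mk (M.Ψ fun u => v (τ u)))

theorem lawQ_empirical [Fintype V] [NeZero k] (v w : Fin k → V) :
    M.lawQ (empirical fun t => (v t, w t)) =
      (iid M.c (PMF.uniformOfFintype (Fin k))).bind (M.sensorLaw v w) := by
  rw [lawQ, jointOutputLaw, empirical, iid_map, PMF.map_comp, PMF.bind_map]; rfl

theorem lawP_empirical [Fintype V] [NeZero k] (v : Fin k → V) :
    M.lawP (empirical v) = (iid M.c (PMF.uniformOfFintype (Fin k))).bind (M.sensorLaw v v) := by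
  rw [lawP, outputLaw, empirical, iid_map, PMF.map_comp, PMF.bind_map]; rfl

open Classical in
theorem prod_sensorLaw (s : Network M.c k n) (v w : Fin k → V) (x : Fin n → X) (y : Fin n → Y) :
    ∏ ℓ, M.sensorLaw v w (s ℓ) (x ℓ, y ℓ) =
      if x = M.codeword s v then M.likelihood (M.codeword s w) y else 0 := by
  have hsensor (ℓ : Fin n) : M.sensorLaw v w (s ℓ) (x ℓ, y ℓ) =
      if x ℓ = M.codeword s v ℓ then M.noise (M.codeword s w ℓ) (y ℓ) else 0 := by
    rw [sensorLaw, PMF.map_apply]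
    by_cases h : x ℓ = M.codeword s v ℓ
    · rw [if_pos h, tsum_eq_single (y ℓ) fun b hb => by simp [hb.symm], h]
      exact if_pos rfl
    · rw [if_neg h]
      exact ENNReal.tsum_eq_zero.2 fun b => if_neg fun hb => h (Prod.ext_iff.1 hb).1
  simp only [hsensor, Finset.prod_ite_zero, funext_iff, Finset.mem_univ, true_imp_iff, likelihood]

theorem tsum_likelihood_rpow_mul_eq (s : Network M.c k n) (v : Fin k → V)
    (W : Finset (Fin k → V)) (r : (Fin k → V) → ℝ≥0∞) {ρ : ℝ} (hρ : 0 < ρ) :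
    ∑' y : Fin n → Y, M.likelihood (M.codeword s v) y ^ (1 - ρ) *
        (∑ w ∈ W, r w * M.likelihood (M.codeword s w) y) ^ ρ =
      ∑' z : Fin n → X × Y, (∏ ℓ, M.sensorLaw v v (s ℓ) (z ℓ)) ^ (1 - ρ) *
        (∑ w ∈ W, r w * ∏ ℓ, M.sensorLaw v w (s ℓ) (z ℓ)) ^ ρ := by
  classical
  rw [← (Equiv.arrowProdEquivProdArrow (Fin n) (fun _ => X) (fun _ => Y)).symm.tsum_eq,
    ENNReal.tsum_prod', ENNReal.tsum_comm]
  refine tsum_congr fun y => ?_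
  simp only [Equiv.arrowProdEquivProdArrow_symm_apply, prod_sensorLaw]
  rw [tsum_eq_single (M.codeword s v) fun x hx => by simp [hx, hρ]]
  simp only [if_true]

theorem sum_randomNetwork_mul_prod_sensorLaw [NeZero k] (v w : Fin k → V) (z : Fin n → X × Y) :
    ∑ s : Network M.c k n, randomNetwork M.c k n s * ∏ ℓ, M.sensorLaw v w (s ℓ) (z ℓ) =
      ∏ ℓ, (iid M.c (PMF.uniformOfFintype (Fin k))).bind (M.sensorLaw v w) (z ℓ) := by
  rw [randomNetwork, sum_iid_mul_prod _ fun ℓ τ => M.sensorLaw v w τ (z ℓ)]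
  simp only [PMF.bind_apply, tsum_fintype]

theorem sum_randomNetwork_mul_likelihood_rpow_le [Fintype V] [NeZero k] {ρ : ℝ}
    (hρ : ρ ∈ Set.Ioc 0 1) (v : Fin k → V) (W : Finset (Fin k → V)) (r : (Fin k → V) → ℝ≥0∞)
    {l : PMF (V × V)} (hW : ∀ w ∈ W, empirical (fun t => (v t, w t)) = l) :
    ∑ s : Network M.c k n, randomNetwork M.c k n s *
        ∑' y : Fin n → Y, M.likelihood (M.codeword s v) y ^ (1 - ρ) *
          (∑ w ∈ W, r w * M.likelihood (M.codeword s w) y) ^ ρ ≤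
      (∑ w ∈ W, r w) ^ ρ * affinity ρ (M.lawP (empirical v)) (M.lawQ l) ^ n := by
  have hmeanQ (z : Fin n → X × Y) : ∑ s : Network M.c k n, randomNetwork M.c k n s *
      ∑ w ∈ W, r w * ∏ ℓ, M.sensorLaw v w (s ℓ) (z ℓ) = (∑ w ∈ W, r w) * ∏ ℓ, M.lawQ l (z ℓ) := by
    simp only [Finset.mul_sum, Finset.sum_mul]
    rw [Finset.sum_comm]
    refine Finset.sum_congr rfl fun w hw => ?_
    rw [← hW w hw, lawQ_empirical, ← sum_randomNetwork_mul_prod_sensorLaw, Finset.mul_sum]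
    exact Finset.sum_congr rfl fun s _ => mul_left_comm _ _ _
  calc _ = ∑' z : Fin n → X × Y, ∑ s : Network M.c k n, randomNetwork M.c k n s *
        ((∏ ℓ, M.sensorLaw v v (s ℓ) (z ℓ)) ^ (1 - ρ) *
          (∑ w ∈ W, r w * ∏ ℓ, M.sensorLaw v w (s ℓ) (z ℓ)) ^ ρ) := by
        simp only [M.tsum_likelihood_rpow_mul_eq _ _ _ _ hρ.1, ← ENNReal.tsum_mul_left]
        exact (Summable.tsum_finsetSum fun _ _ => ENNReal.summable).symm
    _ ≤ ∑' z : Fin n → X × Y, (∏ ℓ, M.lawP (empirical v) (z ℓ)) ^ (1 - ρ) *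
        ((∑ w ∈ W, r w) * ∏ ℓ, M.lawQ l (z ℓ)) ^ ρ := by
        refine ENNReal.tsum_le_tsum fun z => (sum_mul_rpow_mul_rpow_le _ _ _
          (Set.Ioc_subset_Icc_self hρ)).trans_eq ?_
        rw [sum_randomNetwork_mul_prod_sensorLaw, hmeanQ, lawP_empirical]
    _ = (∑ w ∈ W, r w) ^ ρ * affinity ρ (M.lawP (empirical v)) (M.lawQ l) ^ n := by
        rw [← tsum_prod_rpow_mul_prod_rpow hρ, ← ENNReal.tsum_mul_left]
        exact tsum_congr fun z => by rw [ENNReal.mul_rpow_of_nonneg _ _ hρ.1.le, mul_left_comm]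

end Model

theorem le_rpow_mul_rpow {a b : ℝ≥0∞} (h : a ≤ b) {ρ : ℝ} (hρ : ρ ∈ Set.Icc 0 1) :
    a ≤ a ^ (1 - ρ) * b ^ ρ := by
  calc a = a ^ (1 - ρ) * a ^ ρ := by
        rw [← ENNReal.rpow_add_of_nonneg _ _ (sub_nonneg.2 hρ.2) hρ.1, sub_add_cancel,
          ENNReal.rpow_one]
    _ ≤ a ^ (1 - ρ) * b ^ ρ := by gcongr; exact hρ.1

namespace Model

variable {V X Y : Type*} (M : Model V X Y) {k n : ℕ}

theorem tsum_likelihood (x : Fin n → X) : ∑' y, M.likelihood x y = 1 := by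
  simp only [likelihood, tsum_pi_prod fun ℓ y => M.noise (x ℓ) y, PMF.tsum_coe,
    Finset.prod_const_one]

variable [Fintype V]

theorem sum_priorProb : ∑ v : Fin k → V, M.priorProb v = 1 := sum_coe_eq_one (iid k M.prior)

theorem priorProb_eq_exp [NeZero k] {v : Fin k → V} (hv : M.priorProb v ≠ 0) :
    M.priorProb v = ENNReal.ofReal (Real.exp (-(k * crossEntropy (empirical v) M.prior))) := by
  have hpos (t : Fin k) : 0 < (M.prior (v t)).toReal :=
    ENNReal.toReal_pos (Finset.prod_ne_zero_iff.1 hv t (Finset.mem_univ t))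
      (M.prior.apply_ne_top _)
  rw [crossEntropy, ← sum_comp_eq_mul_sum_empirical v fun a => -Real.log (M.prior a).toReal,
    Finset.sum_neg_distrib, neg_neg, Real.exp_sum,
    ENNReal.ofReal_prod_of_nonneg fun t _ => (Real.exp_pos _).le]
  exact Finset.prod_congr rfl fun t _ => by
    rw [Real.exp_log (hpos t), ENNReal.ofReal_toReal (M.prior.apply_ne_top _)]

variable [DecidableEq V]

theorem offDiagMass_empirical [NeZero k] (v w : Fin k → V) :
    offDiagMass (empirical fun t => (v t, w t)) = ENNReal.ofReal (hammingDist v w / k) := by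
  have hsum := sum_comp_eq_mul_sum_empirical (fun t => (v t, w t))
    fun p => if p.1 ≠ p.2 then 1 else 0
  have hdist : ∑ t, (if v t ≠ w t then (1 : ℝ) else 0) = hammingDist v w := by
    rw [hammingDist, Finset.sum_boole]
  simp only [mul_ite, mul_one, mul_zero, hdist] at hsum
  rw [hsum, mul_div_cancel_left₀ _ (NeZero.ne (k : ℝ)), offDiagMass,
    ENNReal.ofReal_sum_of_nonneg fun p _ => by split_ifs <;> simp]
  refine Finset.sum_congr rfl fun p _ => ?_
  split_ifs
  · rw [ENNReal.ofReal_toReal (PMF.apply_ne_top _ _)]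
  · rw [ENNReal.ofReal_zero]

open Classical in
/-- The probability that, when the target vector is `v`, some vector outside the tolerable
distortion region of `v` has at least the posterior probability of `v`. -/
def confusionProb (D : ℝ) (s : Network M.c k n) (v : Fin k → V) : ℝ≥0∞ :=
  ∑' y : Fin n → Y, if ∃ w, ¬ Tolerable D v w ∧ M.priorProb v * M.likelihood (M.codeword s v) y ≤
    M.priorProb w * M.likelihood (M.codeword s w) y then M.likelihood (M.codeword s v) y else 0

theorem errorProb_le {D : ℝ} {s : Network M.c k n} {g : (Fin n → Y) → (Fin k → V)}
    (hg : M.IsMAP s g) : M.errorProb D s g ≤ ∑ v, M.priorProb v * M.confusionProb D s v := by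
  unfold errorProb confusionProb
  gcongr with v _ y
  split_ifs with htol hconf hconf
  · exact zero_le
  · exact le_rfl
  · exact le_rfl
  · exact (hconf ⟨g y, htol, hg y v⟩).elim

theorem confusionProb_le_one (D : ℝ) (s : Network M.c k n) (v : Fin k → V) :
    M.confusionProb D s v ≤ 1 := by
  rw [← M.tsum_likelihood (M.codeword s v)]
  unfold confusionProb
  gcongr with y
  split_ifs
  · exact le_rfl
  · exact zero_le

open Classical in
/-- The joint types of the word `v` and a second word, with off-diagonal mass at least `D`. -/
def rivalTypes [NeZero k] (D : ℝ) (v : Fin k → V) : Finset (PMF (V × V)) :=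
  {l ∈ types (V × V) k | l.map Prod.fst = empirical v ∧ ENNReal.ofReal D ≤ offDiagMass l}

theorem empirical_mem_rivalTypes [NeZero k] {D : ℝ} {v w : Fin k → V} (h : ¬ Tolerable D v w) :
    empirical (fun t => (v t, w t)) ∈ rivalTypes D v := by
  classical
  refine Finset.mem_filter.2 ⟨empirical_mem_types _, map_empirical _ _, ?_⟩
  rw [offDiagMass_empirical]
  exact ENNReal.ofReal_le_ofReal (not_lt.1 h)

open Classical in
theorem priorProb_mul_likelihood_le [NeZero k] {D : ℝ} {s : Network M.c k n} {v w : Fin k → V}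
    {y : Fin n → Y} (hw : ¬ Tolerable D v w)
    (hle : M.priorProb v * M.likelihood (M.codeword s v) y ≤
      M.priorProb w * M.likelihood (M.codeword s w) y) {ρ : ℝ} (hρ : ρ ∈ Set.Icc 0 1) :
    M.priorProb v * M.likelihood (M.codeword s v) y ≤ M.priorProb v ^ (1 - ρ) *
      ∑ l ∈ rivalTypes D v, M.likelihood (M.codeword s v) y ^ (1 - ρ) *
        (∑ w with empirical (fun t => (v t, w t)) = l,
          M.priorProb w * M.likelihood (M.codeword s w) y) ^ ρ := by
  set score : PMF (V × V) → ℝ≥0∞ := fun l =>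
    ∑ w with empirical (fun t => (v t, w t)) = l, M.priorProb w * M.likelihood (M.codeword s w) y
  set l := empirical fun t => (v t, w t)
  have hscore : M.priorProb w * M.likelihood (M.codeword s w) y ≤ score l :=
    Finset.single_le_sum_of_canonicallyOrdered
      (f := fun w => M.priorProb w * M.likelihood (M.codeword s w) y)
      (Finset.mem_filter.2 ⟨Finset.mem_univ w, rfl⟩)
  calc M.priorProb v * M.likelihood (M.codeword s v) y
      ≤ (M.priorProb v * M.likelihood (M.codeword s v) y) ^ (1 - ρ) * score l ^ ρ :=
        le_rpow_mul_rpow (hle.trans hscore) hρ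
    _ = M.priorProb v ^ (1 - ρ) * (M.likelihood (M.codeword s v) y ^ (1 - ρ) * score l ^ ρ) := by
        rw [ENNReal.mul_rpow_of_nonneg _ _ (sub_nonneg.2 hρ.2), mul_assoc]
    _ ≤ M.priorProb v ^ (1 - ρ) *
        ∑ l ∈ rivalTypes D v, M.likelihood (M.codeword s v) y ^ (1 - ρ) * score l ^ ρ := by
        gcongr
        exact Finset.single_le_sum_of_canonicallyOrdered
          (f := fun l => M.likelihood (M.codeword s v) y ^ (1 - ρ) * score l ^ ρ)
          (empirical_mem_rivalTypes hw)

open Classical in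
theorem priorProb_mul_confusionProb_le [NeZero k] (D : ℝ) (s : Network M.c k n) (v : Fin k → V)
    {ρ : ℝ} (hρ : ρ ∈ Set.Icc 0 1) :
    M.priorProb v * M.confusionProb D s v ≤ M.priorProb v ^ (1 - ρ) *
      ∑ l ∈ rivalTypes D v, ∑' y : Fin n → Y, M.likelihood (M.codeword s v) y ^ (1 - ρ) *
        (∑ w with empirical (fun t => (v t, w t)) = l,
          M.priorProb w * M.likelihood (M.codeword s w) y) ^ ρ := by
  rw [← Summable.tsum_finsetSum fun _ _ => ENNReal.summable, confusionProb,
    ← ENNReal.tsum_mul_left, ← ENNReal.tsum_mul_left]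
  refine ENNReal.tsum_le_tsum fun y => ?_
  split_ifs with h
  · obtain ⟨w, hw, hle⟩ := h
    exact M.priorProb_mul_likelihood_le hw hle hρ
  · rw [mul_zero]
    exact zero_le

open Classical in
theorem sum_randomNetwork_mul_confusionProb_le [NeZero k] (D : ℝ) (v : Fin k → V) {ρ : ℝ}
    (hρ : ρ ∈ Set.Ioc 0 1) :
    ∑ s : Network M.c k n, randomNetwork M.c k n s * (M.priorProb v * M.confusionProb D s v) ≤
      ∑ l ∈ rivalTypes D v, M.priorProb v ^ (1 - ρ) *
        ((∑ w with empirical (fun t => (v t, w t)) = l, M.priorProb w) ^ ρ *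
          affinity ρ (M.lawP (empirical v)) (M.lawQ l) ^ n) := by
  refine (Finset.sum_le_sum fun s _ => mul_le_mul_right
    (M.priorProb_mul_confusionProb_le D s v (Set.Ioc_subset_Icc_self hρ)) _).trans ?_
  simp only [mul_left_comm _ (M.priorProb v ^ (1 - ρ)), ← Finset.mul_sum]
  simp only [Finset.mul_sum (rivalTypes D v)]
  rw [Finset.sum_comm, ← Finset.mul_sum]
  gcongr with l
  exact M.sum_randomNetwork_mul_likelihood_rpow_le hρ v _ _ fun w hw => (Finset.mem_filter.1 hw).2

end Model

namespace Model

variable {V X Y : Type*} [Fintype V] (M : Model V X Y) {k n : ℕ}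

open Classical in
theorem sum_priorProb_rpow_mul_affinity_pow_le [NeZero k] {R ρ : ℝ} (hρ : ρ ∈ Set.Ioc 0 1)
    (hk : n * R ≤ k) (v : Fin k → V) {l : PMF (V × V)} (hl : l.map Prod.fst = empirical v)
    {a : ℝ} (ha : ENNReal.ofReal a ≤ ENNReal.ofReal R * kl l (prodPMF (empirical v) M.prior) +
      tsallisDiv ρ (M.lawP (empirical v)) (M.lawQ l)) :
    (∑ w with empirical (fun t => (v t, w t)) = l, M.priorProb w) ^ ρ *
        affinity ρ (M.lawP (empirical v)) (M.lawQ l) ^ n ≤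
      expNeg (ENNReal.ofReal ρ * (n * ENNReal.ofReal a)) := by
  set K := kl l (prodPMF (empirical v) M.prior)
  set T := tsallisDiv ρ (M.lawP (empirical v)) (M.lawQ l)
  have hclass : ∑ w with empirical (fun t => (v t, w t)) = l, M.priorProb w ≤ expNeg (k * K) :=
    (sum_prod_condTypeClass_le M.prior v l).trans_eq (by rw [hl])
  have hnk : (n : ℝ≥0∞) * ENNReal.ofReal R ≤ k := by
    rw [← ENNReal.ofReal_natCast, ← ENNReal.ofReal_mul n.cast_nonneg, ← ENNReal.ofReal_natCast]
    exact ENNReal.ofReal_le_ofReal hk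
  calc _ ≤ expNeg (k * K) ^ ρ * expNeg (ENNReal.ofReal ρ * T) ^ n := by
        gcongr
        exacts [hρ.1.le, affinity_le_expNeg hρ.1 hρ.2 _ _]
    _ = expNeg (ENNReal.ofReal ρ * (k * K + n * T)) := by
        rw [← expNeg_ofReal_mul hρ.1.le, ← expNeg_natCast_mul, ← expNeg_add, mul_add,
          mul_left_comm (n : ℝ≥0∞)]
    _ ≤ expNeg (ENNReal.ofReal ρ * (n * ENNReal.ofReal a)) := by
        refine expNeg_antitone (mul_le_mul_right ?_ _)
        calc (n : ℝ≥0∞) * ENNReal.ofReal a ≤ n * (ENNReal.ofReal R * K + T) := by gcongr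
          _ = n * ENNReal.ofReal R * K + n * T := by rw [mul_add, mul_assoc]
          _ ≤ k * K + n * T := by gcongr

theorem priorProb_rpow_mul_expNeg_le [NeZero k] {R ρ : ℝ} (hR : 0 ≤ R) (hρ : ρ ∈ Set.Icc 0 1)
    (hk : k ≤ n * R + 1) {v : Fin k → V} (hv : M.priorProb v ≠ 0) :
    M.priorProb v ^ (1 - ρ) * expNeg (ENNReal.ofReal ρ *
        (n * ENNReal.ofReal (R * crossEntropy (empirical v) M.prior + ρ))) ≤
      M.priorProb v * ENNReal.ofReal
        (Real.exp (∑ a, -Real.log (M.prior a).toReal - n * ρ ^ 2)) := by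
  have h0 := crossEntropy_nonneg (empirical v) M.prior
  have hC := crossEntropy_le_sum (empirical v) M.prior
  set h := crossEntropy (empirical v) M.prior with hh
  have hslack : ρ * (k * h) ≤ ρ * (n * R * h) + h := by
    calc ρ * (k * h) ≤ ρ * ((n * R + 1) * h) := by gcongr; exact hρ.1
      _ = ρ * (n * R * h) + ρ * h := by ring
      _ ≤ ρ * (n * R * h) + h := by gcongr; exact mul_le_of_le_one_left h0 hρ.2
  have hρ0 := hρ.1
  rw [M.priorProb_eq_exp hv, ← hh, ENNReal.ofReal_rpow_of_pos (Real.exp_pos _), ← Real.exp_mul,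
    ← ENNReal.ofReal_natCast n, ← ENNReal.ofReal_mul n.cast_nonneg, ← ENNReal.ofReal_mul hρ0,
    expNeg_ofReal (by positivity), ← ENNReal.ofReal_mul (Real.exp_pos _).le,
    ← ENNReal.ofReal_mul (Real.exp_pos _).le, ← Real.exp_add, ← Real.exp_add]
  refine ENNReal.ofReal_le_ofReal (Real.exp_le_exp.2 ?_)
  linarith

variable [DecidableEq V]

theorem sum_randomNetwork_mul_confusionProb_le_of_separated [NeZero k] {D R ρ : ℝ} (hR : 0 ≤ R)
    (hρ : ρ ∈ Set.Ioc 0 1) (hsep : ∀ l, ENNReal.ofReal D ≤ offDiagMass l → l ∈ M.separated R ρ)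
    (hk : n * R ≤ k) (hk' : k ≤ n * R + 1) {v : Fin k → V}
    (htyp : kl (empirical v) M.prior ≤ ENNReal.ofReal ρ) :
    ∑ s : Network M.c k n, randomNetwork M.c k n s * (M.priorProb v * M.confusionProb D s v) ≤
      M.priorProb v * (((k : ℝ≥0∞) + 1) ^ Fintype.card (V × V) * ENNReal.ofReal
        (Real.exp (∑ a, -Real.log (M.prior a).toReal - n * ρ ^ 2))) := by
  classical
  by_cases hv : M.priorProb v = 0
  · simp [hv]
  set b := M.priorProb v * ENNReal.ofReal
    (Real.exp (∑ a, -Real.log (M.prior a).toReal - n * ρ ^ 2))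
  have hcard : (rivalTypes D v).card ≤ (k + 1) ^ Fintype.card (V × V) :=
    (Finset.card_filter_le _ _).trans (card_types_le _ _)
  calc _ ≤ ∑ l ∈ rivalTypes D v, M.priorProb v ^ (1 - ρ) *
        ((∑ w with empirical (fun t => (v t, w t)) = l, M.priorProb w) ^ ρ *
          affinity ρ (M.lawP (empirical v)) (M.lawQ l) ^ n) :=
        M.sum_randomNetwork_mul_confusionProb_le D v hρ
    _ ≤ (rivalTypes D v).card • b := by
        refine Finset.sum_le_card_nsmul _ _ _ fun l hl => ?_
        obtain ⟨-, hfst, hoff⟩ := Finset.mem_filter.1 hl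
        have hlt := (hsep l hoff).resolve_left (by rw [hfst]; exact htyp.not_gt)
        rw [hfst] at hlt
        exact (mul_le_mul_right (M.sum_priorProb_rpow_mul_affinity_pow_le hρ hk v hfst hlt.le)
          _).trans (M.priorProb_rpow_mul_expNeg_le hR (Set.Ioc_subset_Icc_self hρ) hk' hv)
    _ ≤ ((k + 1) ^ Fintype.card (V × V) : ℕ) * b := by rw [nsmul_eq_mul]; gcongr
    _ = _ := by push_cast; exact mul_left_comm _ _ _

theorem sum_randomNetwork_mul_sum_confusionProb_le [NeZero k] {D R ρ : ℝ} (hR : 0 ≤ R)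
    (hρ : ρ ∈ Set.Ioc 0 1) (hsep : ∀ l, ENNReal.ofReal D ≤ offDiagMass l → l ∈ M.separated R ρ)
    (hk : n * R ≤ k) (hk' : k ≤ n * R + 1) :
    ∑ s : Network M.c k n, randomNetwork M.c k n s * ∑ v, M.priorProb v * M.confusionProb D s v ≤
      ((k : ℝ≥0∞) + 1) ^ Fintype.card V * expNeg (k * ENNReal.ofReal ρ) +
        ((k : ℝ≥0∞) + 1) ^ Fintype.card (V × V) * ENNReal.ofReal
          (Real.exp (∑ a, -Real.log (M.prior a).toReal - n * ρ ^ 2)) := by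
  classical
  set β := ((k : ℝ≥0∞) + 1) ^ Fintype.card (V × V) * ENNReal.ofReal
    (Real.exp (∑ a, -Real.log (M.prior a).toReal - n * ρ ^ 2))
  have haverage (v : Fin k → V) :
      ∑ s : Network M.c k n, randomNetwork M.c k n s * (M.priorProb v * M.confusionProb D s v) ≤
        (if ENNReal.ofReal ρ < kl (empirical v) M.prior then M.priorProb v else 0) +
          M.priorProb v * β := by
    split_ifs with hv
    · refine le_add_right ?_
      calc _ ≤ ∑ s : Network M.c k n, randomNetwork M.c k n s * M.priorProb v := by
            gcongr with s
            exact mul_le_of_le_one_right zero_le (M.confusionProb_le_one D s v)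
        _ = M.priorProb v := by rw [← Finset.sum_mul, sum_coe_eq_one, one_mul]
    · rw [zero_add]
      exact M.sum_randomNetwork_mul_confusionProb_le_of_separated hR hρ hsep hk hk' (not_lt.1 hv)
  calc _ = ∑ v, ∑ s : Network M.c k n,
        randomNetwork M.c k n s * (M.priorProb v * M.confusionProb D s v) := by
        simp only [Finset.mul_sum]
        exact Finset.sum_comm
    _ ≤ ∑ v : Fin k → V, ((if ENNReal.ofReal ρ < kl (empirical v) M.prior then M.priorProb v else 0)
        + M.priorProb v * β) := Finset.sum_le_sum fun v _ => haverage v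
    _ ≤ _ := by
        rw [Finset.sum_add_distrib, ← Finset.sum_mul, sum_priorProb, one_mul, ← Finset.sum_filter]
        gcongr
        exact sum_prod_kl_gt_le M.prior _

theorem exists_network_forall_errorProb_le [NeZero k] {D R ρ : ℝ} (hR : 0 ≤ R)
    (hρ : ρ ∈ Set.Ioc 0 1) (hsep : ∀ l, ENNReal.ofReal D ≤ offDiagMass l → l ∈ M.separated R ρ)
    (hk : n * R ≤ k) (hk' : k ≤ n * R + 1) :
    ∃ s : Network M.c k n, ∀ g, M.IsMAP s g → M.errorProb D s g ≤
      ((k : ℝ≥0∞) + 1) ^ Fintype.card V * expNeg (k * ENNReal.ofReal ρ) +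
        ((k : ℝ≥0∞) + 1) ^ Fintype.card (V × V) * ENNReal.ofReal
          (Real.exp (∑ a, -Real.log (M.prior a).toReal - n * ρ ^ 2)) := by
  obtain ⟨s, hs⟩ := exists_le_sum_mul (randomNetwork M.c k n)
    fun s => ∑ v, M.priorProb v * M.confusionProb D s v
  exact ⟨s, fun g hg => (M.errorProb_le hg).trans
    (hs.trans (M.sum_randomNetwork_mul_sum_confusionProb_le hR hρ hsep hk hk'))⟩

end Model

theorem tendsto_natCeil_add_one_pow_mul_exp {R η : ℝ} (hR : 0 ≤ R) (hη : 0 < η) (C : ℝ) (d : ℕ) :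
    Tendsto (fun n : ℕ => ((⌈n * R⌉₊ : ℝ) + 1) ^ d * Real.exp (C - n * η)) atTop (𝓝 0) := by
  have hlim : Tendsto (fun n : ℕ => ((R + 2) / η) ^ d * Real.exp C *
      ((n * η) ^ d * Real.exp (-(n * η)))) atTop (𝓝 0) := by
    simpa using ((Real.tendsto_pow_mul_exp_neg_atTop_nhds_zero d).comp
      (tendsto_natCast_atTop_atTop.atTop_mul_const hη)).const_mul (((R + 2) / η) ^ d * Real.exp C)
  refine tendsto_of_tendsto_of_tendsto_of_le_of_le' tendsto_const_nhds hlim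
    (Eventually.of_forall fun n => by positivity) ?_
  filter_upwards [eventually_ge_atTop 1] with n hn
  have hceil : (⌈n * R⌉₊ : ℝ) + 1 ≤ (R + 2) / η * (n * η) := by
    have hn1 : (1 : ℝ) ≤ n := by exact_mod_cast hn
    have hlt := Nat.ceil_lt_add_one (show 0 ≤ n * R by positivity)
    calc (⌈n * R⌉₊ : ℝ) + 1 ≤ (R + 2) * n := by linarith
      _ = (R + 2) / η * (n * η) := by field_simp
  calc ((⌈n * R⌉₊ : ℝ) + 1) ^ d * Real.exp (C - n * η)
      ≤ ((R + 2) / η * (n * η)) ^ d * Real.exp (C - n * η) := by gcongr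
    _ = _ := by rw [mul_pow, sub_eq_add_neg, Real.exp_add]; ring

theorem tendsto_natCeil_add_one_pow_mul_ofReal_exp {R η : ℝ} (hR : 0 ≤ R) (hη : 0 < η) (C : ℝ)
    (d : ℕ) : Tendsto (fun n : ℕ => ((⌈n * R⌉₊ : ℝ≥0∞) + 1) ^ d *
      ENNReal.ofReal (Real.exp (C - n * η))) atTop (𝓝 0) := by
  have hlim := ENNReal.tendsto_ofReal (tendsto_natCeil_add_one_pow_mul_exp hR hη C d)
  rw [ENNReal.ofReal_zero] at hlim
  refine hlim.congr fun n => ?_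
  rw [ENNReal.ofReal_mul (by positivity), ENNReal.ofReal_pow (by positivity),
    ENNReal.ofReal_add (by positivity) zero_le_one, ENNReal.ofReal_natCast, ENNReal.ofReal_one]

theorem tendsto_natCeil_add_one_pow_mul_expNeg {R δ : ℝ} (hR : 0 < R) (hδ : 0 < δ) (d : ℕ) :
    Tendsto (fun n : ℕ => ((⌈n * R⌉₊ : ℝ≥0∞) + 1) ^ d *
      expNeg (⌈n * R⌉₊ * ENNReal.ofReal δ)) atTop (𝓝 0) := by
  refine tendsto_of_tendsto_of_tendsto_of_le_of_le tendsto_const_nhds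
    (tendsto_natCeil_add_one_pow_mul_ofReal_exp hR.le (mul_pos hR hδ) 0 d) (fun _ => zero_le)
      fun n => ?_
  rw [← ENNReal.ofReal_natCast, ← ENNReal.ofReal_mul (Nat.cast_nonneg _),
    expNeg_ofReal (by positivity), zero_sub, ← mul_assoc]
  dsimp only
  gcongr
  exact Nat.le_ceil _

namespace Model

variable {V X Y : Type*} [Fintype V] [DecidableEq V] (M : Model V X Y)

theorem achievable_of_lt_lowerBound {D R : ℝ} (hR : 0 < R)
    (h : ENNReal.ofReal R < M.lowerBound D) : M.Achievable D R := by
  obtain ⟨ρ, hρ, hsep⟩ := M.exists_forall_mem_separated hR h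
  set bound : ℕ → ℝ≥0∞ := fun n =>
    ((⌈n * R⌉₊ : ℝ≥0∞) + 1) ^ Fintype.card V * expNeg (⌈n * R⌉₊ * ENNReal.ofReal ρ) +
      ((⌈n * R⌉₊ : ℝ≥0∞) + 1) ^ Fintype.card (V × V) * ENNReal.ofReal
        (Real.exp (∑ a, -Real.log (M.prior a).toReal - n * ρ ^ 2))
  have hbound : Tendsto bound atTop (𝓝 0) := by
    simpa only [add_zero] using (tendsto_natCeil_add_one_pow_mul_expNeg hR hρ.1 _).add
      (tendsto_natCeil_add_one_pow_mul_ofReal_exp hR.le (pow_pos hρ.1 2) _ _)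
  have hnetwork (n : ℕ) : ∃ s : Network M.c ⌈n * R⌉₊ n, 0 < n →
      ∀ g, M.IsMAP s g → M.errorProb D s g ≤ bound n := by
    rcases n.eq_zero_or_pos with rfl | hn
    · exact ⟨fun ℓ => ℓ.elim0, fun h => (lt_irrefl _ h).elim⟩
    · have hnR : 0 < n * R := by positivity
      have : NeZero ⌈n * R⌉₊ := ⟨(Nat.ceil_pos.2 hnR).ne'⟩
      obtain ⟨s, hs⟩ := M.exists_network_forall_errorProb_le hR.le hρ hsep (Nat.le_ceil _)
        (Nat.ceil_lt_add_one hnR.le).le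
      exact ⟨s, fun _ => hs⟩
  choose s hs using hnetwork
  refine ⟨s, fun g hg => tendsto_of_tendsto_of_tendsto_of_le_of_le' tendsto_const_nhds hbound
    (Eventually.of_forall fun _ => zero_le) ?_⟩
  filter_upwards [eventually_gt_atTop 0] with n hn
  exact hs n hn (g n) (hg n)

end Model

end SensingCapacity

end

theorem mainTheorem6 {V X Y : Type*} [Fintype V] [DecidableEq V]
    (M : SensingCapacity.Model V X Y) (D : ℝ) (hD : D ∈ Set.Icc (0 : ℝ) 1) :
    ((M.feasible D).Nonempty → ∃ l ∈ M.feasible D, M.quotient l = M.lowerBound D) ∧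
      M.lowerBound D ≤ M.capacity D :=
  ⟨M.exists_quotient_eq_lowerBound, le_sSup fun _ hR h => M.achievable_of_lt_lowerBound hR h⟩
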